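/- Let $n\ge 1$ be an integer, let $\mathcal S$ be a finite (possibly empty) set of prime numbers, let $\xi_\infty\in\mathbb R$ and $\xi_p\in\mathbb Q_p$ $(p\in\mathcal S)$, and write $\bar\xi=(\xi_\infty,(\xi_p)_{p\in\mathcal S})$. Let $\lambda_\infty\ge -1$ and $\lambda_p>0$ $(p\in\mathcal S)$ be real numbers such that $\lambda:=\lambda_\infty+\sum_{p\in\mathcal S}\lambda_p>0$. Let $c>0$ be a real number and let $R(T)\in\mathbb Z[T]$ satisfy $R(\xi_p)\in\mathbb Z_p$ for each $p\in\mathcal S$. Suppose that there are arbitrarily large real numbers $X$ for which the system $$\max_{0\le l\le n}|x_l|\le X,\qquad \max_{0\le l\le n}|x_l-x_0\xi_\infty^l|\le cX^{-\lambda_\infty},\qquad \max_{0\le l\le n}|x_l-x_0\xi_p^l|_p\le cX^{-\lambda_p}\quad(p\in\mathcal S)$$ has no non-zero solution $(x_0,\dots,x_n)\in\mathbb Z^{n+1}$. For $F\in\mathbb Z[T]$ let $H(F)$ denote the maximum of the absolute values of its coefficients. Then there exist infinitely many non-zero polynomials $F(T)\in\mathbb Z[T]$ with all of the following properties: (i)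 $\deg(R-F)\le n$; (ii) if $\lambda_\infty>-1$, there exists a root $\alpha_\infty\in\mathbb R$ of $F$ with $$|\xi_\infty-\alpha_\infty|\ll H(F)^{-(\lambda_\infty+1)/\lambda};$$ (iii) for each $p\in\mathcal S$, there exists a root $\alpha_p\in\mathbb Q_p$ of $F$ with $$|\xi_p-\alpha_p|_p\ll H(F)^{-\lambda_p/\lambda},$$ and moreover $\alpha_p$ can be chosen in $\mathbb Z_p$ for each $p\in\mathcal S$ such that $\xi_p\in\mathbb Z_p$. All the implied constants depend only on $\bar\xi$ (including $\mathcal S$), $R$, $n$ and $c$; in particular they do not depend on $F$ or on the exponents $\lambda_\infty,\lambda_p$. -/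

import Mathlib

open Polynomial Filter

noncomputable section

instance primesFactPrime (p : Nat.Primes) : Fact (p : ℕ).Prime := ⟨p.2⟩

/-- `‖x‖_∞`, the maximum of the absolute values of the coordinates of an integer point. -/
def archNorm {n : ℕ} (x : Fin (n + 1) → ℤ) : ℝ :=
  ‖fun l => (x l : ℝ)‖

/-- `L_∞(x) = max_{0 ≤ l ≤ n} |x_l - x_0 ξ_∞ ^ l|`. -/
def archForm {n : ℕ} (ξinf : ℝ) (x : Fin (n + 1) → ℤ) : ℝ :=
  ‖fun l : Fin (n + 1) => (x l : ℝ) - (x 0 : ℝ) * ξinf ^ (l : ℕ)‖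

/-- `L_p(x) = max_{0 ≤ l ≤ n} |x_l - x_0 ξ_p ^ l|_p`. -/
def padicForm {n : ℕ} (p : Nat.Primes) (ξ : ℚ_[(p : ℕ)]) (x : Fin (n + 1) → ℤ) : ℝ :=
  ‖fun l : Fin (n + 1) => (x l : ℚ_[(p : ℕ)]) - (x 0 : ℚ_[(p : ℕ)]) * ξ ^ (l : ℕ)‖

/-- The integer point `x` satisfies the simultaneous system of inequalities with parameter `X`:
`‖x‖_∞ ≤ X`, `L_∞(x) ≤ c X ^ (-λ_∞)` and `L_p(x) ≤ c X ^ (-λ_p)` for all `p ∈ S`. -/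
def SatisfiesSystem {n : ℕ} {S : Finset Nat.Primes}
    (ξinf : ℝ) (ξ : (p : S) → ℚ_[(p.1 : ℕ)]) (laminf : ℝ) (lam : S → ℝ)
    (c X : ℝ) (x : Fin (n + 1) → ℤ) : Prop :=
  archNorm x ≤ X ∧
  archForm ξinf x ≤ c * X ^ (-laminf) ∧
  ∀ p : S, padicForm p.1 (ξ p) x ≤ c * X ^ (-lam p)

/-- `λ = λ_∞ + ∑_{p ∈ S} λ_p`. -/
def totalExponent {S : Finset Nat.Primes} (laminf : ℝ) (lam : S → ℝ) : ℝ :=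
  laminf + ∑ p : S, lam p

/-- The height `H(F)`: the maximum of the absolute values of the coefficients of `F`. -/
def polyHeight (F : ℤ[X]) : ℝ := F.supNorm

end

/-! The proof is a transference argument. Let `N` clear the denominators of all `ξ p`. For a
parameter `X` at which the system has no non-zero solution, take a product `D ≪ X ^ ∑ λ_p` of powers
of the primes of `S` with `|D|_p ≤ c X ^ (-λ_p)`, and an integer `a` that is `D`-close to every `N
ξ_p`. The lattice spanned by `w = (N ^ (n - l) a ^ l)_l` and `D e_1, …, D e_n` lies inside the
`p`-adic conditions. Hence the real forms `x_0 / U`, `(x_l - x_0 ξ_∞ ^ l) / V`, with `U ≍ X` and `V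
≍ X ^ (-λ_∞)`, have sup norm at least 1 at each of its non-zero points.

A lattice without short vectors has a dual lattice that comes within bounded distance of every point
(`exists_dual_lattice_cover`). Scaled by `D N ^ n`, dual points are integer polynomials `B` with
`|B(ξ_p)|_p ≤ |D|_p`. So every real polynomial `Γ` of degree at most `n` is approximated by such a
`B`, up to `X ^ λ` in the non-constant coefficients and up to `X ^ (λ - λ_∞ - 1)` at `ξ_∞`
(`exists_dual_approx`).

A suitable `Γ` yields `F` with `F - R` of degree at most `n`, `F` tiny at every `ξ_p`, `F'(ξ_p)`
bounded below, and at `ξ_∞` a slope of order `X ^ λ` that dominates `F(ξ_∞)`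
(`exists_poly_of_dual_approx`). Hensel's lemma and the intermediate value theorem then give the
roots, and `H(F) ≪ X ^ λ` turns powers of `X` into powers of `H(F)`. Minkowski's theorem also forces
`n λ ≥ 1`, which makes the constants independent of the exponents. -/

/-! ### Geometry of numbers: Minkowski's theorem and covering by the dual lattice. -/

open MeasureTheory Matrix in
/-- Minkowski's theorem on linear forms. -/
theorem exists_int_vec_norm_mulVec_lt {m : ℕ} (A : Matrix (Fin m) (Fin m) ℝ) {r : ℝ} (hr : 0 < r)
    (hdet : A.det ≠ 0) (hlt : |A.det| < r ^ m) :
    ∃ x : Fin m → ℤ, x ≠ 0 ∧ ‖A *ᵥ (fun i => (x i : ℝ))‖ < r := by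
  set b := Pi.basisFun ℝ (Fin m) with hb
  have hf : LinearMap.det (Matrix.toLin' A) ≠ 0 := by rwa [LinearMap.det_toLin']
  have fund := ZSpan.isAddFundamentalDomain' b (volume : Measure (Fin m → ℝ))
  have : Countable (Submodule.span ℤ (Set.range b)).toAddSubgroup :=
    inferInstanceAs (Countable (Submodule.span ℤ (Set.range b)))
  have key : ∃ x ≠ 0, ((x : (Submodule.span ℤ (Set.range b)).toAddSubgroup) : Fin m → ℝ) ∈
      (Matrix.toLin' A) ⁻¹' Metric.ball 0 r := by
    refine exists_ne_zero_mem_lattice_of_measure_mul_two_pow_lt_measure fund ?_ ?_ ?_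
    · intro x hx
      simpa [Matrix.mulVec_neg] using hx
    · exact (convex_ball _ _).linear_preimage _
    · rw [Measure.addHaar_preimage_linearMap _ hf, LinearMap.det_toLin', ZSpan.volume_fundamentalDomain,
        Real.volume_pi_ball _ hr]
      have h1 : (Matrix.of b).det = 1 := by
        have : Matrix.of b = (1 : Matrix (Fin m) (Fin m) ℝ) := by
          ext i j
          simp [hb, Matrix.one_apply, Pi.single_apply, eq_comm]
        rw [this, Matrix.det_one]
      have h2 : (2 : ENNReal) ^ m = ENNReal.ofReal (2 ^ m) := by
        rw [ENNReal.ofReal_pow (by norm_num)]; simp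
      have hpos : 0 < |A.det| := abs_pos.mpr hdet
      rw [h1, Module.finrank_fin_fun, Fintype.card_fin, h2, abs_one, ENNReal.ofReal_one, one_mul,
        ← ENNReal.ofReal_mul (abs_nonneg _), ENNReal.ofReal_lt_ofReal_iff (by positivity), abs_inv,
        mul_pow, ← div_eq_inv_mul, lt_div_iff₀ hpos]
      gcongr
  obtain ⟨⟨x, hx⟩, hx0, hxs⟩ := key
  have hx' : x ∈ Submodule.span ℤ (Set.range b) := hx
  rw [b.mem_span_iff_repr_mem ℤ] at hx'
  choose z hz using hx'
  have hxz : x = fun i => (z i : ℝ) := by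
    ext i
    have := hz i
    simp [hb] at this
    exact this.symm
  refine ⟨z, ?_, ?_⟩
  · rintro rfl
    apply hx0
    ext i
    simp [hxz]
  · subst hxz
    simpa using hxs

theorem norm_sum_orthonormalBasis_le {E : Type*} [NormedAddCommGroup E] [InnerProductSpace ℝ E]
    {m : ℕ} (o : OrthonormalBasis (Fin m) ℝ E) (v : Fin m → ℝ) :
    ‖∑ i, v i • o i‖ ≤ m * ‖v‖ := by
  refine (norm_sum_le _ _).trans ?_
  calc ∑ i, ‖v i • o i‖ ≤ ∑ _i : Fin m, ‖v‖ := by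
        gcongr with i
        rw [norm_smul, o.norm_eq_one, mul_one]
        exact norm_le_pi_norm v i
    _ = m * ‖v‖ := by simp

-- Minkowski's theorem is used twice: on a basis matrix of `L`, where the absence of short vectors
-- bounds the determinant below, and then on the inverse transpose, whose determinant is therefore
-- bounded above.
open Matrix in
theorem exists_short_dual_vector {E : Type*} [NormedAddCommGroup E] [InnerProductSpace ℝ E]
    [FiniteDimensional ℝ E] {m : ℕ} (hm : Module.finrank ℝ E = m) (hm0 : 0 < m)
    (L : Submodule ℤ E) (hspan : Submodule.span ℝ (L : Set E) = ⊤)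
    (hmin : ∀ x ∈ L, x ≠ 0 → 1 ≤ ‖x‖) :
    ∃ y : E, y ≠ 0 ∧ (∀ x ∈ L, ∃ k : ℤ, inner ℝ y x = (k : ℝ)) ∧ ‖y‖ ≤ m * (m + 1) := by
  have : DiscreteTopology L := by
    refine DiscreteTopology.of_forall_le_norm (r := 1) one_pos fun x hx => ?_
    exact hmin x x.2 (by simpa using hx)
  have : IsZLattice ℝ L := ⟨hspan⟩
  have : Module.Free ℤ L := ZLattice.module_free ℝ L
  have : Module.Finite ℤ L := ZLattice.module_finite ℝ L
  let bL := Module.finBasisOfFinrankEq ℤ L ((ZLattice.rank ℝ L).trans hm)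
  let b := bL.ofZLatticeBasis ℝ L
  let o := (stdOrthonormalBasis ℝ E).reindex (finCongr hm)
  let A : Matrix (Fin m) (Fin m) ℝ := o.toBasis.toMatrix b
  have hA : A.det ≠ 0 := by
    have : Invertible A := o.toBasis.invertibleToMatrix b
    exact (Matrix.isUnit_det_of_invertible A).ne_zero
  have hAij : ∀ i j, A i j = inner ℝ (o i) (bL j : E) := by
    intro i j
    simp [A, b, Module.Basis.toMatrix_apply, OrthonormalBasis.repr_apply_apply]
  have hbA : ∀ j, (bL j : E) = ∑ i, A i j • o i := by
    intro j
    simp_rw [hAij]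
    exact (o.sum_repr' _).symm
  have hmR : (0 : ℝ) < m := by exact_mod_cast hm0
  have hAlow : (1 / (m : ℝ)) ^ m ≤ |A.det| := by
    by_contra! hlt
    obtain ⟨x, hx0, hx⟩ := exists_int_vec_norm_mulVec_lt A (by positivity) hA hlt
    let u : L := ∑ j, x j • bL j
    have hu0 : u ≠ 0 := by
      intro hu
      apply hx0
      have := (Fintype.linearIndependent_iff.mp bL.linearIndependent) x hu
      exact funext this
    have huE : (u : E) = ∑ i, (A *ᵥ (fun i => (x i : ℝ))) i • o i := by
      simp only [u, AddSubmonoidClass.coe_finsetSum, Submodule.coe_smul_of_tower, mulVec, dotProduct,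
        Finset.sum_smul]
      rw [Finset.sum_comm]
      refine Finset.sum_congr rfl fun j _ => ?_
      rw [hbA j, Finset.smul_sum]
      refine Finset.sum_congr rfl fun i _ => ?_
      rw [← Int.cast_smul_eq_zsmul ℝ, smul_smul, mul_comm]
    have h1 : 1 ≤ ‖(u : E)‖ := hmin _ u.2 (by simpa using hu0)
    have h2 : ‖(u : E)‖ < 1 := by
      rw [huE]
      refine (norm_sum_orthonormalBasis_le o _).trans_lt ?_
      calc (m : ℝ) * _ < m * (1 / m) := by gcongr
        _ = 1 := by field_simp
    linarith
  have hB : (A⁻¹ᵀ).det ≠ 0 := by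
    rw [det_transpose, det_nonsing_inv, Ring.inverse_eq_inv']
    exact inv_ne_zero hA
  -- The bound is `m ^ m`; using `m + 1` buys the strict inequality Minkowski's theorem needs.
  have hBlt : |(A⁻¹ᵀ).det| < ((m : ℝ) + 1) ^ m := by
    rw [det_transpose, det_nonsing_inv, Ring.inverse_eq_inv', abs_inv]
    calc |A.det|⁻¹ ≤ ((1 / (m : ℝ)) ^ m)⁻¹ := by gcongr
      _ = (m : ℝ) ^ m := by simp
      _ < _ := by gcongr; linarith
  obtain ⟨k, hk0, hk⟩ := exists_int_vec_norm_mulVec_lt _ (by positivity) hB hBlt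
  set t := A⁻¹ᵀ *ᵥ (fun i => (k i : ℝ)) with ht
  have htA : t ᵥ* A = fun i => (k i : ℝ) := by
    rw [ht, mulVec_transpose, vecMul_vecMul, nonsing_inv_mul _ (isUnit_iff_ne_zero.mpr hA),
      vecMul_one]
  have hyb : ∀ j, inner ℝ (∑ i, t i • o i) (bL j : E) = (k j : ℝ) := by
    intro j
    rw [← congrFun htA j, sum_inner]
    simp [vecMul, dotProduct, hAij, inner_smul_left]
  refine ⟨∑ i, t i • o i, ?_, ?_, ?_⟩
  · intro h0
    apply hk0
    ext j
    have := hyb j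
    rw [h0, inner_zero_left] at this
    exact_mod_cast this.symm
  · intro x hx
    have hxs : x = ((∑ j, bL.repr ⟨x, hx⟩ j • bL j : L) : E) := by rw [bL.sum_repr]
    refine ⟨∑ j, bL.repr ⟨x, hx⟩ j * k j, ?_⟩
    conv_lhs => rw [hxs]
    simp only [AddSubmonoidClass.coe_finsetSum, Submodule.coe_smul_of_tower, inner_sum]
    push_cast
    refine Finset.sum_congr rfl fun j _ => ?_
    rw [← Int.cast_smul_eq_zsmul ℝ, real_inner_smul_right, hyb]
  · exact (norm_sum_orthonormalBasis_le o _).trans (by gcongr)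

/-- Induction on the dimension. With `y` a short dual vector, the sublattice of `L` orthogonal to
`y` still has no short vectors, so its dual covers the hyperplane. Dual vectors of the sublattice
lift to `L` by adding a multiple of `y`, and the remaining freedom of integer multiples of `y` costs
at most `‖y‖`. -/
theorem exists_dual_lattice_cover (m : ℕ) : ∃ C : ℝ, 0 ≤ C ∧
    ∀ (E : Type) [NormedAddCommGroup E] [InnerProductSpace ℝ E] [FiniteDimensional ℝ E],
      Module.finrank ℝ E = m → ∀ L : Submodule ℤ E, Submodule.span ℝ (L : Set E) = ⊤ →
      (∀ x ∈ L, x ≠ 0 → 1 ≤ ‖x‖) →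
      ∀ v : E, ∃ z : E, (∀ x ∈ L, ∃ k : ℤ, inner ℝ z x = (k : ℝ)) ∧ ‖v - z‖ ≤ C := by
  induction m with
  | zero =>
    refine ⟨0, le_rfl, fun E _ _ _ hE L _ _ v => ⟨0, fun x _ => ⟨0, by simp⟩, ?_⟩⟩
    have := Module.finrank_zero_iff.mp hE
    simp [Subsingleton.elim v 0]
  | succ m ih =>
    obtain ⟨C, hC, ih⟩ := ih
    refine ⟨C + (m + 1 : ℕ) * ((m + 1 : ℕ) + 1), by positivity, ?_⟩
    intro E _ _ _ hE L hspan hmin v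
    obtain ⟨y, hy0, hyL, hyn⟩ := exists_short_dual_vector hE m.succ_pos L hspan hmin
    choose! f hf using hyL
    let φ : L →ₗ[ℤ] ℤ := (AddMonoidHom.mk' (fun x : L => f x) (by
      intro a b
      have : ((f (a + b : L) : ℤ) : ℝ) = f a + f b := by
        rw [← hf _ (a + b).2, ← hf _ a.2, ← hf _ b.2, ← inner_add_right]
        rfl
      exact_mod_cast this)).toIntLinearMap
    have hφ : ∀ x : L, inner ℝ y (x : E) = (φ x : ℝ) := fun x => hf x x.2
    -- `d` generates the values of `⟨y, ·⟩` on `L`. Subtracting multiples of an `x₀` attaining `d`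
    -- projects `L` onto its part orthogonal to `y`.
    obtain ⟨d, hd⟩ := (IsPrincipalIdealRing.principal (LinearMap.range φ : Ideal ℤ)).principal
    obtain ⟨x₀, hx₀⟩ : ∃ x₀, φ x₀ = d := by
      have : d ∈ LinearMap.range φ := by rw [hd]; exact Submodule.mem_span_singleton_self d
      exact this
    have hdvd : ∀ x : L, ∃ k : ℤ, φ x = k * d := by
      intro x
      have : φ x ∈ LinearMap.range φ := ⟨x, rfl⟩
      rw [hd, Submodule.mem_span_singleton] at this
      obtain ⟨k, hk⟩ := this
      exact ⟨k, hk.symm⟩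
    choose q hq using hdvd
    have hd0 : (d : ℝ) ≠ 0 := by
      intro h
      apply hy0
      have hle : Submodule.span ℝ (L : Set E) ≤ LinearMap.ker (innerₛₗ ℝ y) := by
        rw [Submodule.span_le]
        intro x hx
        have := hφ ⟨x, hx⟩
        rw [hq] at this
        push_cast at this
        rw [h, mul_zero] at this
        simpa using this
      rw [hspan] at hle
      have : y ∈ LinearMap.ker (innerₛₗ ℝ y) := hle trivial
      simpa using this
    let K : Submodule ℝ E := (ℝ ∙ y)ᗮ
    have hK : ∀ w, w ∈ K ↔ inner ℝ y w = 0 := fun w => Submodule.mem_orthogonal_singleton_iff_inner_right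
    let L' : Submodule ℤ K := L.comap (K.subtype.restrictScalars ℤ)
    have hKrank : Module.finrank ℝ K = m := by
      have : Fact (Module.finrank ℝ E = m + 1) := ⟨hE⟩
      exact Submodule.finrank_orthogonal_span_singleton hy0
    have hproj : ∀ x : L, (x : E) - (q x : ℝ) • (x₀ : E) ∈ K := by
      intro x
      rw [hK, inner_sub_right, real_inner_smul_right, hφ, hφ, hq x, hx₀]
      push_cast; ring
    have hprojL : ∀ x : L, (x : E) - (q x : ℝ) • (x₀ : E) ∈ L := by
      intro x
      rw [Int.cast_smul_eq_zsmul]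
      exact L.sub_mem x.2 (L.smul_mem _ x₀.2)
    let π : L → K := fun x => ⟨_, hproj x⟩
    have hπ : ∀ x, π x ∈ L' := hprojL
    have hspan' : Submodule.span ℝ (L' : Set K) = ⊤ := by
      rw [eq_top_iff]
      rintro w -
      have hgen : ∀ u ∈ Submodule.span ℝ (L : Set E),
          ∃ (w : K) (t : ℝ), w ∈ Submodule.span ℝ (L' : Set K) ∧ u = w + t • (x₀ : E) := by
        intro u hu
        induction hu using Submodule.span_induction with
        | mem x hx =>
          exact ⟨π ⟨x, hx⟩, q ⟨x, hx⟩, Submodule.subset_span (hπ _), by simp [π]⟩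
        | zero => exact ⟨0, 0, Submodule.zero_mem _, by simp⟩
        | add a b _ _ ha hb =>
          obtain ⟨w₁, t₁, h₁, rfl⟩ := ha
          obtain ⟨w₂, t₂, h₂, rfl⟩ := hb
          exact ⟨w₁ + w₂, t₁ + t₂, Submodule.add_mem _ h₁ h₂, by push_cast; module⟩
        | smul r a _ ha =>
          obtain ⟨w₁, t₁, h₁, rfl⟩ := ha
          exact ⟨r • w₁, r * t₁, Submodule.smul_mem _ _ h₁, by push_cast; module⟩
      obtain ⟨w', t, hw', hwt⟩ := hgen w (by rw [hspan]; trivial)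
      have ht : t = 0 := by
        have h1 := (hK _).mp w.2
        rw [hwt, inner_add_right, (hK _).mp w'.2, real_inner_smul_right, hφ, hx₀, zero_add] at h1
        exact (mul_eq_zero.mp h1).resolve_right hd0
      have : w = w' := Subtype.ext (by rw [hwt, ht]; simp)
      rwa [this]
    have hyy : (0 : ℝ) < ‖y‖ ^ 2 := by positivity
    let r : ℝ := inner ℝ y v / ‖y‖ ^ 2
    have hvK : v - r • y ∈ K := by
      rw [hK, inner_sub_right, real_inner_smul_right, real_inner_self_eq_norm_sq]
      simp only [r]
      field_simp
      ring
    obtain ⟨z', hz', hvz'⟩ := ih K hKrank L' hspan' (by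
      intro x hx hx0
      exact hmin x hx (by simpa using hx0)) ⟨v - r • y, hvK⟩
    -- This `s` makes `z' - s y` vanish on `x₀`, so its pairing with `x` equals that of `z'` with `π
    -- x`, an integer.
    let s : ℝ := inner ℝ (z' : E) (x₀ : E) / d
    refine ⟨z' + ((round (r + s) : ℤ) - s) • y, ?_, ?_⟩
    · intro x hx
      obtain ⟨k, hk⟩ := hz' (π ⟨x, hx⟩) (hπ _)
      refine ⟨k + round (r + s) * φ ⟨x, hx⟩, ?_⟩
      have h1 : inner ℝ (z' : E) x = k + q ⟨x, hx⟩ * inner ℝ (z' : E) (x₀ : E) := by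
        rw [← hk]
        simp only [π, Submodule.coe_inner, inner_sub_right, real_inner_smul_right]
        ring
      rw [inner_add_left, real_inner_smul_left, hφ ⟨x, hx⟩, h1, hq ⟨x, hx⟩]
      simp only [s]
      push_cast
      field_simp
      ring
    · have h2 : v - (z' + ((round (r + s) : ℤ) - s) • y)
          = ((⟨v - r • y, hvK⟩ - z' : K) : E) + (r + s - round (r + s)) • y := by
        push_cast
        module
      rw [h2]
      refine (norm_add_le _ _).trans (add_le_add hvz' ?_)
      rw [norm_smul, Real.norm_eq_abs]
      calc |r + s - round (r + s)| * ‖y‖ ≤ 1 * ‖y‖ := by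
            gcongr
            exact (abs_sub_round _).trans (by norm_num)
        _ ≤ _ := by rw [one_mul]; exact hyn

theorem norm_ofLp_le_norm {m : ℕ} (x : EuclideanSpace ℝ (Fin m)) : ‖x.ofLp‖ ≤ ‖x‖ :=
  (pi_norm_le_iff_of_nonneg (norm_nonneg _)).mpr fun i => PiLp.norm_apply_le x i

open Matrix in
/-- If a nonsingular system of linear forms has no small integer point, then the integer points of
the dual system are dense on the unit scale. -/
theorem exists_int_vec_add_vecMul (m : ℕ) : ∃ C : ℝ, 0 ≤ C ∧
    ∀ A : Matrix (Fin m) (Fin m) ℝ, A.det ≠ 0 →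
      (∀ x : Fin m → ℤ, x ≠ 0 → 1 ≤ ‖A *ᵥ (fun i => (x i : ℝ))‖) →
      ∀ v : Fin m → ℝ, ∃ (y : Fin m → ℤ) (t : Fin m → ℝ), ‖t‖ ≤ C ∧
        v = (fun i => (y i : ℝ)) + t ᵥ* A := by
  obtain ⟨C, hC, H⟩ := exists_dual_lattice_cover m
  refine ⟨C, hC, fun A hA hmin v => ?_⟩
  let Φ : (Fin m → ℤ) →ₗ[ℤ] EuclideanSpace ℝ (Fin m) :=
    { toFun := fun x => WithLp.toLp 2 (A *ᵥ (fun i => (x i : ℝ)))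
      map_add' := fun x y => by
        rw [← WithLp.toLp_add, ← Matrix.mulVec_add]
        congr 2; ext i; simp
      map_smul' := fun k x => by
        ext i
        simp [Matrix.mulVec, dotProduct, Finset.mul_sum, mul_left_comm] }
  have hΦspan : Submodule.span ℝ (LinearMap.range Φ : Set (EuclideanSpace ℝ (Fin m))) = ⊤ := by
    rw [eq_top_iff]
    rintro w -
    have hw : w = ∑ j, (A⁻¹ *ᵥ w.ofLp) j • Φ (Pi.single j 1) := by
      have h1 : A *ᵥ (A⁻¹ *ᵥ w.ofLp) = w.ofLp := by
        rw [mulVec_mulVec, mul_nonsing_inv _ (isUnit_iff_ne_zero.mpr hA), one_mulVec]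
      have h2 : ∀ j, (fun i => ((Pi.single j (1 : ℤ) : Fin m → ℤ) i : ℝ)) = Pi.single j 1 := by
        intro j; ext i; by_cases h : i = j <;> simp [h]
      ext i
      conv_lhs => rw [← h1]
      simp [Φ, h2, mulVec, dotProduct, mul_comm]
    rw [hw]
    exact Submodule.sum_mem _ fun j _ => Submodule.smul_mem _ _ (Submodule.subset_span ⟨_, rfl⟩)
  have hΦmin : ∀ x ∈ LinearMap.range Φ, x ≠ 0 → 1 ≤ ‖x‖ := by
    rintro _ ⟨x, rfl⟩ hx
    refine (hmin x ?_).trans (norm_ofLp_le_norm (Φ x))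
    rintro rfl
    exact hx (map_zero _)
  obtain ⟨z, hz, hvz⟩ := H (EuclideanSpace ℝ (Fin m)) (by simp) (LinearMap.range Φ) hΦspan hΦmin
    (WithLp.toLp 2 (v ᵥ* A⁻¹))
  have hk : ∀ j, ∃ k : ℤ, (z.ofLp ᵥ* A) j = k := by
    intro j
    obtain ⟨k, hk⟩ := hz (Φ (Pi.single j 1)) ⟨_, rfl⟩
    refine ⟨k, ?_⟩
    rw [← hk]
    have : (fun i => ((Pi.single j (1 : ℤ) : Fin m → ℤ) i : ℝ)) = Pi.single j 1 := by
      ext i; by_cases h : i = j <;> simp [h]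
    simp [Φ, this, PiLp.inner_apply, vecMul, dotProduct, mul_comm]
  choose y hy using hk
  refine ⟨y, v ᵥ* A⁻¹ - z.ofLp, ?_, ?_⟩
  · exact (norm_ofLp_le_norm (WithLp.toLp 2 (v ᵥ* A⁻¹) - z)).trans hvz
  · rw [sub_vecMul, vecMul_vecMul, nonsing_inv_mul _ (isUnit_iff_ne_zero.mpr hA), vecMul_one,
      show (fun i => (y i : ℝ)) = z.ofLp ᵥ* A from funext fun i => (hy i).symm]
    abel

/-! ### `p`-adic approximation and Hensel's lemma. -/

/-- Simultaneous approximation of `p`-adic integers by a rational integer. -/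
theorem exists_int_norm_sub_le (S : Finset Nat.Primes) (η : (p : S) → ℚ_[(p.1 : ℕ)])
    (hη : ∀ p, ‖η p‖ ≤ 1) (m : S → ℕ) :
    ∃ a : ℤ, ∀ p : S, ‖(a : ℚ_[(p.1 : ℕ)]) - η p‖ ≤ ((p.1 : ℕ) : ℝ) ^ (-(m p : ℤ)) := by
  have hco : Set.Pairwise (Finset.univ : Finset S)
      (Function.onFun Nat.Coprime fun p : S => ((p.1 : ℕ)) ^ m p) := by
    intro p _ q _ hpq
    refine Nat.Coprime.pow _ _ ((Nat.coprime_primes p.1.2 q.1.2).mpr fun h => hpq ?_)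
    exact Subtype.ext (Subtype.ext h)
  let k := Nat.chineseRemainderOfFinset (fun p : S => PadicInt.appr (⟨η p, hη p⟩ : ℤ_[(p.1 : ℕ)]) (m p))
    (fun p : S => (p.1 : ℕ) ^ m p) Finset.univ (fun p _ => pow_ne_zero _ p.1.2.ne_zero) hco
  refine ⟨(k : ℕ), fun p => ?_⟩
  set x : ℤ_[(p.1 : ℕ)] := ⟨η p, hη p⟩ with hx
  have h1 : ‖(((k : ℕ) : ℤ_[(p.1 : ℕ)])) - (x.appr (m p) : ℕ)‖ ≤ ((p.1 : ℕ) : ℝ) ^ (-(m p : ℤ)) := by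
    have h := (k.2 p (Finset.mem_univ p)).symm.dvd
    rw [PadicInt.norm_le_pow_iff_mem_span_pow, Ideal.mem_span_singleton]
    have := map_dvd (Int.castRingHom ℤ_[(p.1 : ℕ)]) h
    simpa using this
  have h2 : ‖x - (x.appr (m p) : ℕ)‖ ≤ ((p.1 : ℕ) : ℝ) ^ (-(m p : ℤ)) := by
    rw [PadicInt.norm_le_pow_iff_mem_span_pow]
    exact PadicInt.appr_spec _ _
  have h3 : ‖((k : ℕ) : ℤ_[(p.1 : ℕ)]) - x‖ ≤ ((p.1 : ℕ) : ℝ) ^ (-(m p : ℤ)) := by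
    rw [← sub_sub_sub_cancel_right _ _ ((x.appr (m p) : ℕ) : ℤ_[(p.1 : ℕ)])]
    rw [sub_eq_add_neg (_ - _) (x - _)]
    exact (PadicInt.nonarchimedean _ _).trans (max_le h1 (by rwa [norm_neg]))
  rw [PadicInt.norm_def, PadicInt.coe_sub, PadicInt.coe_natCast] at h3
  rw [Int.cast_natCast]
  exact h3

/-- In the Taylor expansion of `G` at `a`, the linear term strictly dominates the remainder by the
ultrametric inequality. -/
theorem PadicInt.norm_root_sub_le {p : ℕ} [Fact p.Prime] (G : ℤ_[p][X]) {a z : ℤ_[p]}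
    (hz : G.eval z = 0) (hza : ‖z - a‖ < ‖G.derivative.eval a‖) :
    ‖z - a‖ * ‖G.derivative.eval a‖ ≤ ‖G.eval a‖ := by
  obtain ⟨k, hk⟩ := G.binomExpansion a (z - a)
  rw [add_sub_cancel, hz] at hk
  have h1 : -G.eval a = (z - a) * (G.derivative.eval a + k * (z - a)) := by linear_combination hk
  have h2 : ‖k * (z - a)‖ < ‖G.derivative.eval a‖ := by
    rw [norm_mul]
    exact (mul_le_of_le_one_left (norm_nonneg _) (PadicInt.norm_le_one k)).trans_lt hza
  rw [← norm_neg (G.eval a), h1, norm_mul,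
    PadicInt.norm_add_eq_max_of_ne h2.ne', max_eq_left h2.le]

/-- A form of Hensel's lemma for roots in `ℚ_[p]` of an integer polynomial, near a point whose
denominator divides `N`. -/
theorem exists_padic_root_near {p : ℕ} [Fact p.Prime] (F : ℤ[X]) {N : ℤ} (hN : N ≠ 0) {d : ℕ}
    (hd : F.natDegree ≤ d) {ξ : ℚ_[p]} (hξ : ‖(N : ℚ_[p]) * ξ‖ ≤ 1)
    (hder : ‖(N : ℚ_[p])‖ ≤ ‖aeval ξ (derivative F)‖)
    (hval : ‖aeval ξ F‖ < ‖(N : ℚ_[p])‖ ^ (2 * d)) :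
    ∃ α : ℚ_[p], aeval α F = 0 ∧ ‖ξ - α‖ ≤ ‖aeval ξ F‖ / ‖(N : ℚ_[p])‖ := by
  have hN0 : (N : ℚ_[p]) ≠ 0 := by exact_mod_cast hN
  have hNpos : 0 < ‖(N : ℚ_[p])‖ := norm_pos_iff.mpr hN0
  have hN1 : ‖(N : ℚ_[p])‖ ≤ 1 := Padic.norm_int_le_one N
  set e := F.natDegree with he
  -- `G (N x) = N ^ e F(x)`, so Hensel's lemma can be applied to `G` at the `p`-adic integer `N ξ`.
  set G := F.scaleRoots N with hG
  have hcomp : G.comp (C N * X) = C (N ^ e) * F := by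
    ext i
    rw [comp_C_mul_X_coeff, hG, coeff_scaleRoots, coeff_C_mul]
    rcases le_or_gt i e with hi | hi
    · rw [mul_assoc, ← pow_add, ← he, Nat.sub_add_cancel hi, mul_comm]
    · rw [coeff_eq_zero_of_natDegree_lt hi]; simp
  have hGx : ∀ x : ℚ_[p], aeval ((N : ℚ_[p]) * x) G = (N : ℚ_[p]) ^ e * aeval x F := by
    intro x
    have := congrArg (aeval x) hcomp
    simpa [aeval_comp] using this
  have hGd : (N : ℚ_[p]) * aeval ((N : ℚ_[p]) * ξ) (derivative G)
      = (N : ℚ_[p]) ^ e * aeval ξ (derivative F) := by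
    have := congrArg (fun P => aeval ξ (derivative P)) hcomp
    simpa [-map_pow, -eq_intCast, aeval_comp, derivative_comp] using this
  let a : ℤ_[p] := ⟨N * ξ, hξ⟩
  have hcoe : ∀ (P : ℤ[X]) (x : ℤ_[p]), ‖aeval x P‖ = ‖aeval (x : ℚ_[p]) P‖ := by
    intro P x
    have := aeval_algebraMap_apply ℚ_[p] x P
    rw [PadicInt.norm_def]
    exact congrArg norm this.symm
  have hva : ‖aeval a G‖ = ‖(N : ℚ_[p])‖ ^ e * ‖aeval ξ F‖ := by
    rw [hcoe, show (a : ℚ_[p]) = N * ξ from rfl, hGx, norm_mul, norm_pow]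
  have hda : ‖(N : ℚ_[p])‖ * ‖aeval a (derivative G)‖
      = ‖(N : ℚ_[p])‖ ^ e * ‖aeval ξ (derivative F)‖ := by
    rw [hcoe, show (a : ℚ_[p]) = N * ξ from rfl, ← norm_mul, hGd, norm_mul, norm_pow]
  have hdlow : ‖(N : ℚ_[p])‖ ^ e ≤ ‖aeval a (derivative G)‖ := by
    refine le_of_mul_le_mul_left ?_ hNpos
    rw [hda, mul_comm]
    gcongr
  have hlt : ‖aeval a G‖ < ‖aeval a (derivative G)‖ ^ 2 := by
    calc ‖aeval a G‖ ≤ ‖aeval ξ F‖ := by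
          rw [hva]; exact mul_le_of_le_one_left (norm_nonneg _) (pow_le_one₀ (norm_nonneg _) hN1)
      _ < ‖(N : ℚ_[p])‖ ^ (2 * d) := hval
      _ ≤ ‖(N : ℚ_[p])‖ ^ (2 * e) := pow_le_pow_of_le_one (norm_nonneg _) hN1 (by omega)
      _ = (‖(N : ℚ_[p])‖ ^ e) ^ 2 := by ring
      _ ≤ _ := by gcongr
  obtain ⟨z, hz, hza, -⟩ := hensels_lemma hlt
  have hmap : ∀ (P : ℤ[X]) (x : ℤ_[p]), aeval x P = (P.map (Int.castRingHom ℤ_[p])).eval x := by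
    intro P x
    rw [eval_map]; rfl
  have hdist : ‖z - a‖ * ‖aeval a (derivative G)‖ ≤ ‖aeval a G‖ := by
    have := PadicInt.norm_root_sub_le (G.map (Int.castRingHom ℤ_[p])) (a := a) (z := z)
    rw [derivative_map, ← hmap, ← hmap, ← hmap] at this
    exact this hz hza
  have hzα : (z : ℚ_[p]) = N * (z / N) := by field_simp
  refine ⟨z / N, ?_, ?_⟩
  · have h0 : aeval (z : ℚ_[p]) G = 0 := by
      have := hcoe G z
      rw [hz, norm_zero] at this
      exact norm_eq_zero.mp this.symm
    rw [hzα, hGx] at h0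
    exact (mul_eq_zero.mp h0).resolve_left (pow_ne_zero _ hN0)
  · have h1 : ‖z - a‖ = ‖(N : ℚ_[p])‖ * ‖ξ - z / N‖ := by
      rw [← norm_mul, PadicInt.norm_def, PadicInt.coe_sub, norm_sub_rev,
        show (a : ℚ_[p]) = N * ξ from rfl, mul_sub, ← hzα]
    rw [h1, hva, mul_comm ‖(N : ℚ_[p])‖ ‖ξ - _‖, mul_assoc, hda] at hdist
    rw [le_div_iff₀ hNpos]
    have hpe : 0 < ‖(N : ℚ_[p])‖ ^ e := by positivity
    refine le_of_mul_le_mul_left ?_ hpe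
    calc _ = ‖ξ - z / N‖ * (‖(N : ℚ_[p])‖ ^ e * ‖(N : ℚ_[p])‖) := by ring
      _ ≤ ‖ξ - z / N‖ * (‖(N : ℚ_[p])‖ ^ e * ‖aeval ξ (derivative F)‖) := by gcongr
      _ ≤ _ := hdist

/-- An integer clearing the denominators of finitely many `p`-adic numbers. -/
theorem exists_nat_norm_mul_le_one (S : Finset Nat.Primes) (ξ : (p : S) → ℚ_[(p.1 : ℕ)]) :
    ∃ N : ℕ, 0 < N ∧ ∀ p : S, ‖(N : ℚ_[(p.1 : ℕ)]) * ξ p‖ ≤ 1 := by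
  have h : ∀ p : S, ∃ k : ℕ, ‖((p.1 : ℕ) : ℚ_[(p.1 : ℕ)]) ^ k * ξ p‖ ≤ 1 := by
    intro p
    have ht : Tendsto (fun k : ℕ => ‖((p.1 : ℕ) : ℚ_[(p.1 : ℕ)])‖ ^ k * ‖ξ p‖) atTop (nhds (0 * ‖ξ p‖)) :=
      (tendsto_pow_atTop_nhds_zero_of_lt_one (norm_nonneg _) Padic.norm_p_lt_one).mul_const _
    rw [zero_mul] at ht
    obtain ⟨k, hk⟩ := (ht.eventually_lt_const one_pos).exists
    exact ⟨k, by rw [norm_mul, norm_pow]; exact hk.le⟩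
  choose k hk using h
  refine ⟨∏ p : S, (p.1 : ℕ) ^ k p, Finset.prod_pos fun p _ => pow_pos p.1.2.pos _, fun p => ?_⟩
  rw [← Finset.mul_prod_erase _ _ (Finset.mem_univ p)]
  push_cast
  rw [mul_right_comm, norm_mul]
  refine mul_le_one₀ (hk p) (norm_nonneg _) ?_
  have := Padic.norm_int_le_one (p := (p.1 : ℕ)) (∏ q ∈ Finset.univ.erase p, ((q.1 : ℕ) : ℤ) ^ k q)
  exact_mod_cast this

/-! ### The lattice attached to `N`, `D`, `a`, and the polynomials of its dual. -/

noncomputable section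

/-- Matrix of the forms `x₀ / U`, `(x_l - x₀ ξ ^ l) / V` in the basis `w, D e₁, …, D e_n` of the
lattice `ℤ w + D ℤ ^ (n + 1) ∩ {x₀ = 0}`, where `w_l = N ^ (n - l) a ^ l`. -/
def formMatrix (n : ℕ) (N D : ℕ) (a : ℤ) (ξ U V : ℝ) : Matrix (Fin (n + 1)) (Fin (n + 1)) ℝ :=
  Matrix.of (Fin.cons (Fin.cons ((N : ℝ) ^ n / U) 0)
    (fun i : Fin n => Fin.cons
      (((N : ℝ) ^ (n - (i + 1)) * a ^ ((i : ℕ) + 1) - N ^ n * ξ ^ ((i : ℕ) + 1)) / V)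
      (Pi.single i ((D : ℝ) / V))))

/-- The integer polynomial corresponding to the point `y` of the dual lattice. -/
def dualPoly (n : ℕ) (N D : ℕ) (a : ℤ) (y : Fin (n + 1) → ℤ) : ℤ[X] :=
  C (D * y 0) + ∑ i : Fin n, C (y i.succ) *
    (C ((N : ℤ) ^ n) * X ^ ((i : ℕ) + 1) - C ((N : ℤ) ^ (n - (i + 1)) * a ^ ((i : ℕ) + 1)))

/-- The integer point `z₀ w + D (0, z₁, …, z_n)` with `w_l = N ^ (n - l) a ^ l`. -/
def latticePoint (n : ℕ) (N D : ℕ) (a : ℤ) (z : Fin (n + 1) → ℤ) : Fin (n + 1) → ℤ :=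
  Fin.cons ((N : ℤ) ^ n * z 0)
    (fun i : Fin n => (N : ℤ) ^ (n - (i + 1)) * a ^ ((i : ℕ) + 1) * z 0 + D * z i.succ)

section
variable {n N D : ℕ} {a : ℤ} {ξ U V : ℝ}

theorem det_formMatrix : (formMatrix n N D a ξ U V).det = (N : ℝ) ^ n / U * (D / V) ^ n := by
  rw [Matrix.det_of_isLowerTriangular, Fin.prod_univ_succ]
  · simp [formMatrix, div_pow]
  · intro i j hij
    have hij : i < j := hij
    induction j using Fin.cases with
    | zero => simp at hij
    | succ j =>
      induction i using Fin.cases with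
      | zero => simp [formMatrix]
      | succ i =>
        have : j ≠ i := (Fin.succ_lt_succ_iff.mp hij).ne'
        simp [formMatrix, this]

theorem formMatrix_mulVec_zero (z : Fin (n + 1) → ℝ) :
    (formMatrix n N D a ξ U V).mulVec z 0 = (N : ℝ) ^ n / U * z 0 := by
  simp [Matrix.mulVec, dotProduct, Fin.sum_univ_succ, formMatrix]

theorem formMatrix_mulVec_succ (z : Fin (n + 1) → ℝ) (i : Fin n) :
    (formMatrix n N D a ξ U V).mulVec z i.succ =
      ((N : ℝ) ^ (n - (i + 1)) * a ^ ((i : ℕ) + 1) - N ^ n * ξ ^ ((i : ℕ) + 1)) / V * z 0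
        + D / V * z i.succ := by
  simp [Matrix.mulVec, dotProduct, Fin.sum_univ_succ, formMatrix, Pi.single_apply]

theorem vecMul_formMatrix_zero (t : Fin (n + 1) → ℝ) :
    Matrix.vecMul t (formMatrix n N D a ξ U V) 0 = t 0 * ((N : ℝ) ^ n / U) +
      ∑ i : Fin n, t i.succ *
        (((N : ℝ) ^ (n - (i + 1)) * a ^ ((i : ℕ) + 1) - N ^ n * ξ ^ ((i : ℕ) + 1)) / V) := by
  simp [Matrix.vecMul, dotProduct, Fin.sum_univ_succ, formMatrix]

theorem vecMul_formMatrix_succ (t : Fin (n + 1) → ℝ) (i : Fin n) :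
    Matrix.vecMul t (formMatrix n N D a ξ U V) i.succ = t i.succ * (D / V) := by
  simp [Matrix.vecMul, dotProduct, Fin.sum_univ_succ, formMatrix, Pi.single_apply]

theorem natDegree_dualPoly_le (y : Fin (n + 1) → ℤ) : (dualPoly n N D a y).natDegree ≤ n := by
  refine natDegree_add_le_of_degree_le (by rw [natDegree_C]; exact n.zero_le) (natDegree_sum_le_of_forall_le _ _ fun i _ => ?_)
  refine (natDegree_C_mul_le _ _).trans ?_
  rw [natDegree_sub_C]
  exact (natDegree_C_mul_X_pow_le _ _).trans i.2

theorem aeval_dualPoly {A : Type*} [CommRing A] (x : A) (y : Fin (n + 1) → ℤ) :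
    aeval x (dualPoly n N D a y) = D * y 0 + ∑ i : Fin n, (y i.succ : A) *
      ((N : A) ^ n * x ^ ((i : ℕ) + 1) - (N : A) ^ (n - (i + 1)) * (a : A) ^ ((i : ℕ) + 1)) := by
  simp [dualPoly]

theorem coeff_dualPoly_succ (y : Fin (n + 1) → ℤ) (i : Fin n) :
    (dualPoly n N D a y).coeff (i + 1) = N ^ n * y i.succ := by
  simp only [dualPoly, coeff_add, finsetSum_coeff, coeff_C_mul, coeff_sub, coeff_X_pow,
    coeff_C_succ, add_left_inj, ← Fin.ext_iff]
  simp [mul_comm]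

theorem latticePoint_ne_zero (hN : 0 < N) (hD : 0 < D) {z : Fin (n + 1) → ℤ} (hz : z ≠ 0) :
    latticePoint n N D a z ≠ 0 := by
  intro h
  apply hz
  have h0 : z 0 = 0 := by
    have := congrFun h 0
    simp only [latticePoint, Fin.cons_zero, Pi.zero_apply, mul_eq_zero] at this
    exact this.resolve_left (pow_ne_zero _ (by exact_mod_cast hN.ne'))
  ext i
  induction i using Fin.cases with
  | zero => exact h0
  | succ i =>
    have := congrFun h i.succ
    simp only [latticePoint, Fin.cons_succ, h0, mul_zero, zero_add, Pi.zero_apply,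
      mul_eq_zero] at this
    exact this.resolve_left (by exact_mod_cast hD.ne')

/-- The difference is `N ^ (n - k)` times `(N η) ^ k - a ^ k`, which is divisible by `N η - a` in
`ℤ_[p]`. This one estimate serves both the lattice points and the dual polynomials. -/
theorem norm_formPadic_le {p : ℕ} [Fact p.Prime] {η : ℚ_[p]} (hη : ‖(N : ℚ_[p]) * η‖ ≤ 1)
    (ha : ‖(a : ℚ_[p]) - N * η‖ ≤ ‖(D : ℚ_[p])‖) (k : ℕ) (hk : k ≤ n) :
    ‖(N : ℚ_[p]) ^ n * η ^ k - (N : ℚ_[p]) ^ (n - k) * (a : ℚ_[p]) ^ k‖ ≤ ‖(D : ℚ_[p])‖ := by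
  have hN1 : ‖(N : ℚ_[p])‖ ≤ 1 := by exact_mod_cast Padic.norm_int_le_one (p := p) N
  have h1 : (N : ℚ_[p]) ^ n * η ^ k - (N : ℚ_[p]) ^ (n - k) * (a : ℚ_[p]) ^ k
      = N ^ (n - k) * ((N * η) ^ k - (a : ℚ_[p]) ^ k) := by
    conv_lhs => rw [← Nat.sub_add_cancel hk, pow_add]
    simp only [Nat.add_sub_cancel]
    ring
  have h2 : ‖((N : ℚ_[p]) * η) ^ k - (a : ℚ_[p]) ^ k‖ ≤ ‖(N : ℚ_[p]) * η - a‖ := by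
    let u : ℤ_[p] := ⟨N * η, hη⟩
    obtain ⟨q, hq⟩ := sub_dvd_pow_sub_pow u (a : ℤ_[p]) k
    have h3 : ‖u ^ k - (a : ℤ_[p]) ^ k‖ ≤ ‖u - a‖ := by
      rw [hq, norm_mul]
      exact mul_le_of_le_one_right (norm_nonneg _) (PadicInt.norm_le_one q)
    exact h3
  rw [h1, norm_mul, norm_pow]
  refine (mul_le_of_le_one_left (norm_nonneg _) (pow_le_one₀ (norm_nonneg _) hN1)).trans ?_
  exact h2.trans (by rwa [norm_sub_rev])

theorem norm_aeval_dualPoly_le {p : ℕ} [Fact p.Prime] {η : ℚ_[p]}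
    (hη : ‖(N : ℚ_[p]) * η‖ ≤ 1) (ha : ‖(a : ℚ_[p]) - N * η‖ ≤ ‖(D : ℚ_[p])‖)
    (y : Fin (n + 1) → ℤ) : ‖aeval η (dualPoly n N D a y)‖ ≤ ‖(D : ℚ_[p])‖ := by
  rw [aeval_dualPoly]
  refine (Padic.nonarchimedean _ _).trans (max_le ?_ ?_)
  · rw [norm_mul]
    exact mul_le_of_le_one_right (norm_nonneg _) (Padic.norm_int_le_one _)
  · refine IsUltrametricDist.norm_sum_le_of_forall_le_of_nonneg (norm_nonneg _) fun i _ => ?_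
    rw [norm_mul]
    exact (mul_le_of_le_one_left (norm_nonneg _) (Padic.norm_int_le_one _)).trans
      (norm_formPadic_le hη ha _ i.2)

theorem padicForm_latticePoint_le {p : Nat.Primes} {η : ℚ_[(p : ℕ)]}
    (hη : ‖(N : ℚ_[(p : ℕ)]) * η‖ ≤ 1) (ha : ‖(a : ℚ_[(p : ℕ)]) - N * η‖ ≤ ‖(D : ℚ_[(p : ℕ)])‖)
    (z : Fin (n + 1) → ℤ) : padicForm p η (latticePoint n N D a z) ≤ ‖(D : ℚ_[(p : ℕ)])‖ := by
  rw [padicForm, pi_norm_le_iff_of_nonneg (norm_nonneg _)]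
  intro i
  induction i using Fin.cases with
  | zero => simp
  | succ i =>
    have h1 := norm_formPadic_le hη ha (i + 1) i.2
    have h2 : ((latticePoint n N D a z i.succ : ℤ) : ℚ_[(p : ℕ)])
          - ((latticePoint n N D a z 0 : ℤ) : ℚ_[(p : ℕ)]) * η ^ ((i.succ : Fin (n + 1)) : ℕ)
        = D * z i.succ + (z 0 : ℚ_[(p : ℕ)]) * -((N : ℚ_[(p : ℕ)]) ^ n * η ^ ((i : ℕ) + 1)
          - (N : ℚ_[(p : ℕ)]) ^ (n - (i + 1)) * (a : ℚ_[(p : ℕ)]) ^ ((i : ℕ) + 1)) := by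
      simp only [latticePoint, Fin.cons_zero, Fin.cons_succ, Fin.val_succ]
      push_cast
      ring
    rw [h2]
    refine (Padic.nonarchimedean _ _).trans (max_le ?_ ?_)
    · rw [norm_mul]
      exact mul_le_of_le_one_right (norm_nonneg _) (Padic.norm_int_le_one _)
    · rw [norm_mul, norm_neg]
      exact (mul_le_of_le_one_left (norm_nonneg _) (Padic.norm_int_le_one _)).trans h1

theorem abs_latticePoint_zero_lt (hU : 0 < U) {z : Fin (n + 1) → ℤ}
    (hz : ‖(formMatrix n N D a ξ U V).mulVec (fun i => (z i : ℝ))‖ < 1) :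
    |(latticePoint n N D a z 0 : ℝ)| < U := by
  have h := (norm_le_pi_norm _ (0 : Fin (n + 1))).trans_lt hz
  rw [formMatrix_mulVec_zero, Real.norm_eq_abs, div_mul_eq_mul_div, abs_div, abs_of_pos hU,
    div_lt_one hU] at h
  simpa [latticePoint] using h

theorem archForm_latticePoint_le (hV : 0 < V) {z : Fin (n + 1) → ℤ}
    (hz : ‖(formMatrix n N D a ξ U V).mulVec (fun i => (z i : ℝ))‖ < 1) :
    archForm ξ (latticePoint n N D a z) ≤ V := by
  rw [archForm, pi_norm_le_iff_of_nonneg hV.le]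
  intro i
  induction i using Fin.cases with
  | zero => simpa using hV.le
  | succ i =>
    have h := ((norm_le_pi_norm _ i.succ).trans_lt hz).le
    rw [formMatrix_mulVec_succ, div_mul_eq_mul_div, div_mul_eq_mul_div, ← add_div,
      Real.norm_eq_abs, abs_div, abs_of_pos hV, div_le_one hV] at h
    rw [Real.norm_eq_abs]
    have h2 : (latticePoint n N D a z i.succ : ℝ)
          - (latticePoint n N D a z 0 : ℝ) * ξ ^ ((i.succ : Fin (n + 1)) : ℕ)
        = ((N : ℝ) ^ (n - (i + 1)) * a ^ ((i : ℕ) + 1) - N ^ n * ξ ^ ((i : ℕ) + 1)) * z 0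
          + D * z i.succ := by
      simp only [latticePoint, Fin.cons_zero, Fin.cons_succ, Fin.val_succ]
      push_cast
      ring
    rwa [h2]

theorem archNorm_le_of_archForm_le {x : Fin (n + 1) → ℤ} (h0 : |(x 0 : ℝ)| ≤ U)
    (h : archForm ξ x ≤ V) : archNorm x ≤ U * (1 + |ξ|) ^ n + V := by
  have hU : 0 ≤ U := (abs_nonneg _).trans h0
  have hV : 0 ≤ V := (norm_nonneg _).trans h
  rw [archNorm, pi_norm_le_iff_of_nonneg (by positivity)]
  intro i
  have h1 : ‖(x i : ℝ) - x 0 * ξ ^ (i : ℕ)‖ ≤ V := (norm_le_pi_norm _ i).trans h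
  have h2 : ‖(x 0 : ℝ) * ξ ^ (i : ℕ)‖ ≤ U * (1 + |ξ|) ^ n := by
    rw [norm_mul, norm_pow, Real.norm_eq_abs, Real.norm_eq_abs]
    gcongr
    calc |ξ| ^ (i : ℕ) ≤ (1 + |ξ|) ^ (i : ℕ) := by gcongr; linarith
      _ ≤ (1 + |ξ|) ^ n := pow_le_pow_right₀ (by linarith [abs_nonneg ξ]) (by omega)
  calc ‖(x i : ℝ)‖ = ‖(x 0 : ℝ) * ξ ^ (i : ℕ) + ((x i : ℝ) - x 0 * ξ ^ (i : ℕ))‖ := by ring_nf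
    _ ≤ _ := (norm_add_le _ _).trans (add_le_add h2 h1)

/-- On evaluation at `ξ` the contributions of `t 1, …, t n` cancel and only `-t 0 * D * N ^ n / U`
is left. This is why the error there involves `U` and not `V`. -/
theorem exists_dualPoly_near (hN : 0 < N) (hD : 0 < D) (hU : 0 < U) (hV : 0 < V) {K : ℝ}
    (hcov : ∀ v : Fin (n + 1) → ℝ, ∃ (y : Fin (n + 1) → ℤ) (t : Fin (n + 1) → ℝ), ‖t‖ ≤ K ∧
      v = (fun i => (y i : ℝ)) + Matrix.vecMul t (formMatrix n N D a ξ U V))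
    (Γ : ℝ[X]) (hΓ : Γ.natDegree ≤ n) :
    ∃ y : Fin (n + 1) → ℤ,
      |aeval ξ (dualPoly n N D a y) - Γ.eval ξ| ≤ K * D * N ^ n / U ∧
      ∀ l, 1 ≤ l → |((dualPoly n N D a y).coeff l : ℝ) - Γ.coeff l| ≤ K * D * N ^ n / V := by
  have hNR : (0 : ℝ) < N := by exact_mod_cast hN
  have hDR : (0 : ℝ) < D := by exact_mod_cast hD
  -- `v₀` and `v'` are the coordinates of `Γ` in the basis `D`, `N ^ n X ^ i - N ^ (n - i) a ^ i`
  -- for `1 ≤ i ≤ n`.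
  let v' : Fin n → ℝ := fun i => Γ.coeff (i + 1) / N ^ n
  let v₀ : ℝ := (Γ.coeff 0 + ∑ i : Fin n, v' i * ((N : ℝ) ^ (n - (i + 1)) * a ^ ((i : ℕ) + 1))) / D
  obtain ⟨y, t, ht, hv⟩ := hcov (Fin.cons v₀ v')
  have hti : ∀ i, |t i| ≤ K := fun i => (norm_le_pi_norm t i).trans ht
  have hK : 0 ≤ K := (norm_nonneg _).trans ht
  have hy0 : v₀ = y 0 + (t 0 * ((N : ℝ) ^ n / U) + ∑ i : Fin n, t i.succ *
        (((N : ℝ) ^ (n - (i + 1)) * a ^ ((i : ℕ) + 1) - N ^ n * ξ ^ ((i : ℕ) + 1)) / V)) := by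
    rw [← vecMul_formMatrix_zero]
    simpa using congrFun hv 0
  have hyi : ∀ i, v' i = y i.succ + t i.succ * (D / V) := by
    intro i
    rw [← vecMul_formMatrix_succ (ξ := ξ) (U := U) (N := N) (a := a)]
    simpa using congrFun hv i.succ
  refine ⟨y, ?_, ?_⟩
  · have hΓξ : Γ.eval ξ = D * v₀ + ∑ i : Fin n, v' i *
        ((N : ℝ) ^ n * ξ ^ ((i : ℕ) + 1) - (N : ℝ) ^ (n - (i + 1)) * a ^ ((i : ℕ) + 1)) := by
      rw [eval_eq_sum_range' (Nat.lt_succ_of_le hΓ), Finset.sum_range, Fin.sum_univ_succ]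
      simp only [v₀, mul_div_cancel₀ _ hDR.ne', mul_sub, Finset.sum_sub_distrib]
      have : ∀ i : Fin n, v' i * ((N : ℝ) ^ n * ξ ^ ((i : ℕ) + 1))
          = Γ.coeff (i + 1) * ξ ^ ((i : ℕ) + 1) := by
        intro i; simp only [v']; field_simp
      simp only [this]
      simp
    have hdiff : aeval ξ (dualPoly n N D a y) - Γ.eval ξ = -(t 0 * D * N ^ n / U) := by
      rw [aeval_dualPoly, hΓξ, hy0]
      simp only [hyi, add_mul, Finset.sum_add_distrib, mul_add, Finset.mul_sum]
      have : ∑ i : Fin n, (D : ℝ) * (t i.succ *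
          (((N : ℝ) ^ (n - (i + 1)) * a ^ ((i : ℕ) + 1) - N ^ n * ξ ^ ((i : ℕ) + 1)) / V))
          = - ∑ i : Fin n, t i.succ * (D / V) *
          ((N : ℝ) ^ n * ξ ^ ((i : ℕ) + 1) - (N : ℝ) ^ (n - (i + 1)) * a ^ ((i : ℕ) + 1)) := by
        rw [← Finset.sum_neg_distrib]
        refine Finset.sum_congr rfl fun i _ => ?_
        ring
      rw [this]
      ring
    rw [hdiff, abs_neg, abs_div, abs_mul, abs_mul, abs_of_pos hU, abs_of_pos hDR,
      abs_of_pos (pow_pos hNR n)]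
    gcongr
    exact hti 0
  · intro l hl
    rcases le_or_gt l n with hln | hln
    · obtain ⟨i, rfl⟩ : ∃ i : Fin n, (i : ℕ) + 1 = l := ⟨⟨l - 1, by omega⟩, by simp; omega⟩
      rw [coeff_dualPoly_succ]
      have : Γ.coeff (i + 1) = N ^ n * (y i.succ + t i.succ * (D / V)) := by
        rw [← hyi]; simp only [v']; field_simp
      rw [this]
      have h2 : (((N : ℤ) ^ n * y i.succ : ℤ) : ℝ) - N ^ n * (y i.succ + t i.succ * (D / V))
          = -(t i.succ * D * N ^ n / V) := by
        push_cast; ring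
      rw [h2, abs_neg, abs_div, abs_mul, abs_mul, abs_of_pos hV, abs_of_pos hDR,
        abs_of_pos (pow_pos hNR n)]
      gcongr
      exact hti _
    · rw [coeff_eq_zero_of_natDegree_lt ((natDegree_dualPoly_le y).trans_lt hln),
        coeff_eq_zero_of_natDegree_lt (hΓ.trans_lt hln)]
      simp
      positivity
end

end

/-! ### Choice of the modulus and construction of `F`. -/

theorem exists_zpow_neg_le {p : ℕ} (hp : 1 < p) {ε : ℝ} (hε : 0 < ε) :
    ∃ m : ℕ, (p : ℝ) ^ (-(m : ℤ)) ≤ ε ∧ (p : ℝ) ^ m ≤ p * max 1 ε⁻¹ := by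
  have hpR : (1 : ℝ) < p := by exact_mod_cast hp
  obtain ⟨m, h1, h2⟩ := exists_nat_pow_near (le_max_left 1 ε⁻¹) hpR
  refine ⟨m + 1, ?_, ?_⟩
  · rw [zpow_neg, zpow_natCast]
    exact inv_le_of_inv_le₀ hε ((le_max_right _ _).trans h2.le)
  · rw [pow_succ, mul_comm]
    gcongr

theorem exists_int_norm_sub_le_of_pos (S : Finset Nat.Primes) (η : (p : S) → ℚ_[(p.1 : ℕ)])
    (hη : ∀ p, ‖η p‖ ≤ 1) (δ : S → ℝ) (hδ : ∀ p, 0 < δ p) :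
    ∃ a : ℤ, ∀ p : S, ‖(a : ℚ_[(p.1 : ℕ)]) - η p‖ ≤ δ p := by
  choose m hm _ using fun p : S => exists_zpow_neg_le p.1.2.one_lt (hδ p)
  obtain ⟨a, ha⟩ := exists_int_norm_sub_le S η hη m
  exact ⟨a, fun p => (ha p).trans (hm p)⟩

/-- A modulus of controlled size divisible by prescribed powers of the primes of `S`. -/
theorem exists_modulus (S : Finset Nat.Primes) {c X : ℝ} (hc : 0 < c) (hX : 1 ≤ X) (lam : S → ℝ)
    (hlam : ∀ p, 0 < lam p) :
    ∃ D : ℕ, 0 < D ∧ (∀ p : S, ‖(D : ℚ_[(p.1 : ℕ)])‖ ≤ c * X ^ (-lam p)) ∧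
      (D : ℝ) ≤ (∏ p : S, ((p.1 : ℕ) : ℝ) * max 1 c⁻¹) * X ^ (∑ p : S, lam p) := by
  have hX0 : 0 < X := one_pos.trans_le hX
  choose m hm hm' using fun p : S =>
    exists_zpow_neg_le p.1.2.one_lt (ε := c * X ^ (-lam p)) (by positivity)
  refine ⟨∏ p : S, (p.1 : ℕ) ^ m p, Finset.prod_pos fun p _ => pow_pos p.1.2.pos _, fun p => ?_, ?_⟩
  · refine le_trans ?_ (hm p)
    rw [← Finset.mul_prod_erase _ _ (Finset.mem_univ p), Nat.cast_mul, norm_mul, Nat.cast_pow,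
      Padic.norm_p_pow]
    refine mul_le_of_le_one_right (by positivity) ?_
    exact_mod_cast Padic.norm_int_le_one (p := (p.1 : ℕ)) (∏ q ∈ Finset.univ.erase p, ((q.1 : ℕ) : ℤ) ^ m q)
  · rw [Real.rpow_sum_of_pos hX0, ← Finset.prod_mul_distrib]
    push_cast
    refine Finset.prod_le_prod (fun _ _ => by positivity) fun p _ => (hm' p).trans ?_
    rw [mul_assoc]
    gcongr
    have h1 : 1 ≤ X ^ lam p := Real.one_le_rpow hX (hlam p).le
    rw [mul_inv, Real.rpow_neg hX0.le, inv_inv]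
    refine max_le ?_ ?_
    · exact one_le_mul_of_one_le_of_one_le (le_max_left _ _) h1
    · gcongr
      exact le_max_right _ _

theorem norm_pow_mul_aeval_le_one {p : ℕ} [Fact p.Prime] {N : ℕ} {η : ℚ_[p]}
    (hη : ‖(N : ℚ_[p]) * η‖ ≤ 1) {P : ℤ[X]} {k : ℕ} (hP : P.natDegree ≤ k) :
    ‖(N : ℚ_[p]) ^ k * aeval η P‖ ≤ 1 := by
  have hN1 : ‖(N : ℚ_[p])‖ ≤ 1 := by exact_mod_cast Padic.norm_int_le_one (p := p) N
  rw [aeval_eq_sum_range' (Nat.lt_succ_of_le hP), Finset.mul_sum]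
  refine IsUltrametricDist.norm_sum_le_of_forall_le_of_nonneg zero_le_one fun i hi => ?_
  have hik : i ≤ k := Nat.lt_succ_iff.mp (Finset.mem_range.mp hi)
  have : (N : ℚ_[p]) ^ k * P.coeff i • η ^ i
      = (P.coeff i : ℚ_[p]) * (N ^ (k - i) * (N * η) ^ i) := by
    conv_lhs => rw [← Nat.sub_add_cancel hik, pow_add]
    rw [zsmul_eq_mul, mul_pow]
    ring
  rw [this, norm_mul, norm_mul, norm_pow, norm_pow]
  exact mul_le_one₀ (Padic.norm_int_le_one _) (by positivity)
    (mul_le_one₀ (pow_le_one₀ (norm_nonneg _) hN1) (by positivity) (pow_le_one₀ (norm_nonneg _) hη))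

/-- An integer which perturbs each derivative `r p` into a number of absolute value at least `|N|`. -/
theorem exists_int_norm_le_norm_add_mul (S : Finset Nat.Primes) (r : (p : S) → ℚ_[(p.1 : ℕ)])
    {N : ℕ} (hN : 0 < N) :
    ∃ b : ℤ, ∀ p : S, ‖(N : ℚ_[(p.1 : ℕ)])‖ ≤ ‖r p + b * N‖ := by
  classical
  -- Take for `b` the product of the primes where `r p` is already large enough: there `b N` is too
  -- small to disturb `r p`, and elsewhere `b` is a unit, so `b N` dominates.
  let T : Finset S := Finset.univ.filter fun p => ‖(N : ℚ_[(p.1 : ℕ)])‖ ≤ ‖r p‖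
  refine ⟨∏ q ∈ T, ((q.1 : ℕ) : ℤ), fun p => ?_⟩
  have hN0 : (0 : ℝ) < ‖(N : ℚ_[(p.1 : ℕ)])‖ := norm_pos_iff.mpr (by exact_mod_cast hN.ne')
  by_cases hp : ‖(N : ℚ_[(p.1 : ℕ)])‖ ≤ ‖r p‖
  · have hb : ‖((∏ q ∈ T, ((q.1 : ℕ) : ℤ) : ℤ) : ℚ_[(p.1 : ℕ)])‖ < 1 := by
      rw [Padic.norm_intCast_lt_one_iff]
      exact Finset.dvd_prod_of_mem (fun q : S => ((q.1 : ℕ) : ℤ)) (by simpa [T] using hp)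
    have hlt : ‖((∏ q ∈ T, ((q.1 : ℕ) : ℤ) : ℤ) : ℚ_[(p.1 : ℕ)]) * N‖ < ‖r p‖ := by
      rw [norm_mul]
      exact (mul_lt_of_lt_one_left hN0 hb).trans_le hp
    rw [Padic.add_eq_max_of_ne hlt.ne', max_eq_left hlt.le]
    exact hp
  · push Not at hp
    have hb : ‖((∏ q ∈ T, ((q.1 : ℕ) : ℤ) : ℤ) : ℚ_[(p.1 : ℕ)])‖ = 1 := by
      refine le_antisymm (Padic.norm_int_le_one _) ?_
      by_contra! hlt
      rw [Padic.norm_intCast_lt_one_iff,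
        (Nat.prime_iff_prime_int.mp p.1.2).dvd_finsetProd_iff] at hlt
      obtain ⟨q, hq, hpq⟩ := hlt
      have hpq' : (p.1 : ℕ) = q.1 := (Nat.prime_dvd_prime_iff_eq p.1.2 q.1.2).mp (by exact_mod_cast hpq)
      have : p = q := Subtype.ext (Subtype.ext hpq')
      subst this
      simp only [T, Finset.mem_filter] at hq
      exact hp.not_ge hq.2
    have hbN : ‖((∏ q ∈ T, ((q.1 : ℕ) : ℤ) : ℤ) : ℚ_[(p.1 : ℕ)]) * N‖ = ‖(N : ℚ_[(p.1 : ℕ)])‖ := by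
      rw [norm_mul, hb, one_mul]
    rw [Padic.add_eq_max_of_ne (by rw [hbN]; exact hp.ne), hbN]
    exact le_max_right _ _

/-- Take `F = R + Q + M₀ B`. The linear `Q` makes `R + Q` small at each `ξ p` with derivative of
norm at least `|N|`; the factor `M₀` keeps `B` from spoiling that derivative; and `Γ` is chosen so
that, over the reals, `Q + M₀ B` is close to a line of slope `M` whose value at `ξinf` is
`-R(ξinf)`. -/
theorem exists_poly_of_dual_approx {n : ℕ} (hn : 1 ≤ n) (S : Finset Nat.Primes)
    (ξinf : ℝ) (ξ : (p : S) → ℚ_[(p.1 : ℕ)]) (R : ℤ[X]) (hR : ∀ p : S, ‖aeval (ξ p) R‖ ≤ 1)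
    {N D : ℕ} (hN : 0 < N) (hD : 0 < D) (hNξ : ∀ p : S, ‖(N : ℚ_[(p.1 : ℕ)]) * ξ p‖ ≤ 1)
    {a : ℤ} (ha : ∀ p : S, ‖(a : ℚ_[(p.1 : ℕ)]) - N * ξ p‖ ≤ ‖(D : ℚ_[(p.1 : ℕ)])‖) {ε₁ ε₂ : ℝ}
    (hB : ∀ Γ : ℝ[X], Γ.natDegree ≤ n → ∃ B : ℤ[X], B.natDegree ≤ n ∧
      (∀ p : S, ‖aeval (ξ p) B‖ ≤ ‖(D : ℚ_[(p.1 : ℕ)])‖) ∧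
      |aeval ξinf B - Γ.eval ξinf| ≤ ε₁ ∧
      ∀ l, 1 ≤ l → |(B.coeff l : ℝ) - Γ.coeff l| ≤ ε₂) (M : ℝ) :
    ∃ F : ℤ[X], (F - R).natDegree ≤ n ∧
      (∀ p : S, ‖aeval (ξ p) F‖ ≤ ‖(D : ℚ_[(p.1 : ℕ)])‖ ∧
        ‖(N : ℚ_[(p.1 : ℕ)])‖ ≤ ‖aeval (ξ p) (derivative F)‖) ∧
      |aeval ξinf F| ≤ (N ^ n * ∏ p : S, (p.1 : ℕ) : ℕ) * ε₁ ∧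
      ∀ l, 1 ≤ l → |(F.coeff l : ℝ) - R.coeff l - (C M * X : ℝ[X]).coeff l|
        ≤ (N ^ n * ∏ p : S, (p.1 : ℕ) : ℕ) * ε₂ := by
  obtain ⟨b, hb⟩ := exists_int_norm_le_norm_add_mul S (fun p => aeval (ξ p) (derivative R)) hN
  obtain ⟨s, hs⟩ := exists_int_norm_sub_le_of_pos S (fun p => -aeval (ξ p) R)
    (fun p => by rw [norm_neg]; exact hR p) (fun p => ‖(D : ℚ_[(p.1 : ℕ)])‖)
    (fun p => norm_pos_iff.mpr (by exact_mod_cast hD.ne'))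
  -- `N ^ (n - 1)` makes `B'(ξ p)` integral; the extra `N` and the factor `p` make the product
  -- strictly smaller than `|N|`.
  set M₀ : ℕ := N ^ n * ∏ p : S, (p.1 : ℕ) with hM₀
  have hM₀pos : 0 < M₀ := Nat.mul_pos (pow_pos hN _) (Finset.prod_pos fun p _ => p.1.2.pos)
  have hM₀R : (0 : ℝ) < M₀ := by exact_mod_cast hM₀pos
  let Q : ℤ[X] := C s + C b * (C (N : ℤ) * X - C a)
  have hQdeg : Q.natDegree ≤ n := by
    refine natDegree_add_le_of_degree_le (by rw [natDegree_C]; exact n.zero_le) ?_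
    refine (natDegree_C_mul_le _ _).trans ?_
    rw [natDegree_sub_C]
    exact ((natDegree_C_mul_le _ _).trans natDegree_X_le).trans hn
  let G : ℝ[X] := C M * X + C (-aeval ξinf R - M * ξinf)
  have hGdeg : G.natDegree ≤ n := by
    refine natDegree_add_le_of_degree_le (((natDegree_C_mul_le _ _).trans natDegree_X_le).trans hn) ?_
    rw [natDegree_C]; exact n.zero_le
  -- Subtracting `Q` removes its coefficients, whose size is not controlled, from the final
  -- estimates.
  let Γ : ℝ[X] := C ((M₀ : ℝ)⁻¹) * (G - Q.map (Int.castRingHom ℝ))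
  have hΓdeg : Γ.natDegree ≤ n := by
    refine (natDegree_C_mul_le _ _).trans ((natDegree_sub_le _ _).trans (max_le hGdeg ?_))
    exact natDegree_map_le.trans hQdeg
  obtain ⟨B, hBdeg, hBp, hBinf, hBl⟩ := hB Γ hΓdeg
  refine ⟨R + Q + C (M₀ : ℤ) * B, ?_, fun p => ⟨?_, ?_⟩, ?_, ?_⟩
  · rw [add_assoc, add_sub_cancel_left]
    exact natDegree_add_le_of_degree_le hQdeg ((natDegree_C_mul_le _ _).trans hBdeg)
  · have : aeval (ξ p) (R + Q + C (M₀ : ℤ) * B)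
        = ((s : ℚ_[(p.1 : ℕ)]) - -aeval (ξ p) R) + (b * -(a - N * ξ p) + (M₀ : ℤ) * aeval (ξ p) B) := by
      simp [Q]; ring
    rw [this]
    refine (Padic.nonarchimedean _ _).trans (max_le (hs p)
      ((Padic.nonarchimedean _ _).trans (max_le ?_ ?_)))
    · rw [norm_mul, norm_neg]
      exact (mul_le_of_le_one_left (norm_nonneg _) (Padic.norm_int_le_one _)).trans (ha p)
    · rw [norm_mul]
      exact (mul_le_of_le_one_left (norm_nonneg _) (Padic.norm_int_le_one _)).trans (hBp p)
  · have hN0 : (0 : ℝ) < ‖(N : ℚ_[(p.1 : ℕ)])‖ := norm_pos_iff.mpr (by exact_mod_cast hN.ne')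
    have hd : aeval (ξ p) (derivative (R + Q + C (M₀ : ℤ) * B))
        = (aeval (ξ p) (derivative R) + b * N) + M₀ * aeval (ξ p) (derivative B) := by
      have hQ' : derivative Q = C (b * N) := by simp [Q]
      rw [derivative_add, derivative_add, hQ', derivative_C_mul, map_add, map_add, map_mul]
      simp
    have hprod : ‖((∏ p : S, (p.1 : ℕ) : ℕ) : ℚ_[(p.1 : ℕ)])‖ < 1 := by
      rw [Padic.norm_natCast_lt_one_iff]
      exact Finset.dvd_prod_of_mem (fun q : S => (q.1 : ℕ)) (Finset.mem_univ p)
    have hsmall : ‖(M₀ : ℚ_[(p.1 : ℕ)]) * aeval (ξ p) (derivative B)‖ < ‖(N : ℚ_[(p.1 : ℕ)])‖ := by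
      have h1 := norm_pow_mul_aeval_le_one (hNξ p) (P := derivative B) (k := n - 1)
        ((natDegree_derivative_le _).trans (by omega))
      have h2 : (M₀ : ℚ_[(p.1 : ℕ)]) * aeval (ξ p) (derivative B)
          = N * ((∏ p : S, (p.1 : ℕ) : ℕ) * (N ^ (n - 1) * aeval (ξ p) (derivative B))) := by
        rw [hM₀, Nat.cast_mul, Nat.cast_pow]
        conv_lhs => rw [← Nat.sub_add_cancel hn, pow_succ]
        ring
      rw [h2, norm_mul, norm_mul]
      refine mul_lt_of_lt_one_right hN0 ?_
      exact (mul_le_of_le_one_right (norm_nonneg _) h1).trans_lt hprod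
    have hlt := hsmall.trans_le (hb p)
    rw [hd, Padic.add_eq_max_of_ne hlt.ne', max_eq_left hlt.le]
    exact hb p
  · have : aeval ξinf (R + Q + C (M₀ : ℤ) * B) = M₀ * (aeval ξinf B - Γ.eval ξinf) := by
      have hQe : (Q.map (Int.castRingHom ℝ)).eval ξinf = aeval ξinf Q := by
        rw [eval_map]; rfl
      simp only [Γ, eval_mul, eval_C, eval_sub, hQe, mul_sub, mul_inv_cancel_left₀ hM₀R.ne', G,
        eval_add, eval_X, map_add, map_mul]
      simp
      ring
    rw [this, abs_mul, abs_of_pos hM₀R]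
    gcongr
  · intro l hl
    have : (((R + Q + C (M₀ : ℤ) * B).coeff l : ℤ) : ℝ) - R.coeff l - (C M * X : ℝ[X]).coeff l
        = M₀ * ((B.coeff l : ℝ) - Γ.coeff l) := by
      have hG : G.coeff l = (C M * X : ℝ[X]).coeff l := by
        simp only [G, coeff_add, coeff_C, if_neg (Nat.one_le_iff_ne_zero.mp hl), add_zero]
      simp only [Γ, coeff_C_mul, coeff_sub, coeff_map, mul_sub, mul_inv_cancel_left₀ hM₀R.ne', hG,
        coeff_add]
      push_cast
      simp
      ring
    rw [this, abs_mul, abs_of_pos hM₀R]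
    gcongr
    exact hBl l hl

theorem exists_dual_approx (n : ℕ) (S : Finset Nat.Primes) (ξinf : ℝ)
    (ξ : (p : S) → ℚ_[(p.1 : ℕ)]) {c : ℝ} (hc : 0 < c) {N : ℕ} (hN : 0 < N)
    (hNξ : ∀ p : S, ‖(N : ℚ_[(p.1 : ℕ)]) * ξ p‖ ≤ 1) :
    ∃ K : ℝ, 0 < K ∧ ∀ (laminf : ℝ) (lam : S → ℝ) (X : ℝ), -1 ≤ laminf → (∀ p, 0 < lam p) → 1 ≤ X →
      (¬ ∃ x : Fin (n + 1) → ℤ, x ≠ 0 ∧ SatisfiesSystem ξinf ξ laminf lam c X x) →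
      X ^ (1 - n * totalExponent laminf lam) ≤ K ∧
      ∃ (D : ℕ) (a : ℤ), 0 < D ∧
        (∀ p : S, ‖(a : ℚ_[(p.1 : ℕ)]) - N * ξ p‖ ≤ ‖(D : ℚ_[(p.1 : ℕ)])‖) ∧
        (∀ p : S, ‖(D : ℚ_[(p.1 : ℕ)])‖ ≤ c * X ^ (-lam p)) ∧
        ∀ Γ : ℝ[X], Γ.natDegree ≤ n → ∃ B : ℤ[X], B.natDegree ≤ n ∧
          (∀ p : S, ‖aeval (ξ p) B‖ ≤ ‖(D : ℚ_[(p.1 : ℕ)])‖) ∧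
          |aeval ξinf B - Γ.eval ξinf|
            ≤ K * (X ^ totalExponent laminf lam * X ^ (-(laminf + 1))) ∧
          ∀ l, 1 ≤ l → |(B.coeff l : ℝ) - Γ.coeff l| ≤ K * X ^ totalExponent laminf lam := by
  obtain ⟨C₀, hC₀, hcov⟩ := exists_int_vec_add_vecMul (n + 1)
  have hNR : (0 : ℝ) < N := by exact_mod_cast hN
  set κ : ℝ := (1 + |ξinf|) ^ n with hκ
  have hκ0 : 0 < κ := by positivity
  -- With `V ≤ c₁ X`, which uses `λ_∞ ≥ -1`, the choice `c₁ (κ + 1) ≤ 1` gives `archNorm ≤ X`.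
  set c₁ : ℝ := min c (κ + 1)⁻¹ with hc₁
  have hc₁0 : 0 < c₁ := lt_min hc (by positivity)
  set CD : ℝ := ∏ p : S, ((p.1 : ℕ) : ℝ) * max 1 c⁻¹
  have hCD0 : 0 < CD := Finset.prod_pos fun p _ =>
    mul_pos (by exact_mod_cast p.1.2.pos) (lt_max_of_lt_left one_pos)
  set K₁ : ℝ := (N : ℝ) ^ n * CD ^ n / c₁ ^ (n + 1) with hK₁
  set K₂ : ℝ := C₀ * CD * N ^ n / c₁ with hK₂
  have hK₁0 : 0 < K₁ := by positivity
  have hK₂0 : 0 ≤ K₂ := by positivity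
  refine ⟨K₁ + K₂, by positivity, fun laminf lam X hlaminf hlam hX hno => ?_⟩
  have hX0 : 0 < X := one_pos.trans_le hX
  obtain ⟨D, hD, hDp, hDle⟩ := exists_modulus S hc hX lam hlam
  obtain ⟨a, ha⟩ := exists_int_norm_sub_le_of_pos S (fun p => (N : ℚ_[(p.1 : ℕ)]) * ξ p) hNξ
    (fun p => ‖(D : ℚ_[(p.1 : ℕ)])‖) (fun p => norm_pos_iff.mpr (by exact_mod_cast hD.ne'))
  have hDR : (0 : ℝ) < D := by exact_mod_cast hD
  set U : ℝ := c₁ * X with hU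
  set V : ℝ := c₁ * X ^ (-laminf) with hV
  have hU0 : 0 < U := by positivity
  have hV0 : 0 < V := by positivity
  have hmin : ∀ z : Fin (n + 1) → ℤ, z ≠ 0 →
      1 ≤ ‖(formMatrix n N D a ξinf U V).mulVec (fun i => (z i : ℝ))‖ := by
    intro z hz
    by_contra! hlt
    apply hno
    have harch := archForm_latticePoint_le hV0 hlt
    refine ⟨latticePoint n N D a z, latticePoint_ne_zero hN hD hz, ?_, ?_, fun p => ?_⟩
    · refine (archNorm_le_of_archForm_le (abs_latticePoint_zero_lt hU0 hlt).le harch).trans ?_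
      have h1 : V ≤ c₁ * X := by
        rw [hV]
        gcongr
        conv_rhs => rw [← Real.rpow_one X]
        exact Real.rpow_le_rpow_of_exponent_le hX (by linarith)
      calc U * κ + V ≤ c₁ * X * κ + c₁ * X := by rw [hU]; gcongr
        _ = c₁ * (κ + 1) * X := by ring
        _ ≤ (κ + 1)⁻¹ * (κ + 1) * X := by gcongr; exact min_le_right _ _
        _ = X := by field_simp
    · refine harch.trans ?_
      rw [hV]
      gcongr
      exact min_le_left _ _
    · exact (padicForm_latticePoint_le (hNξ p) (ha p) z).trans (hDp p)
  have hdet : (formMatrix n N D a ξinf U V).det = (N : ℝ) ^ n / U * (D / V) ^ n := det_formMatrix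
  have hdet0 : (formMatrix n N D a ξinf U V).det ≠ 0 := by rw [hdet]; positivity
  have hDU : (D : ℝ) / U ≤ CD / c₁ * (X ^ totalExponent laminf lam * X ^ (-(laminf + 1))) := by
    have h : X ^ totalExponent laminf lam * X ^ (-(laminf + 1)) = X ^ (∑ p : S, lam p) / X := by
      rw [← Real.rpow_add hX0, ← Real.rpow_sub_one hX0.ne', totalExponent]
      congr 1; ring
    rw [h, hU, div_mul_div_comm]
    gcongr
  have hDV : (D : ℝ) / V ≤ CD / c₁ * X ^ totalExponent laminf lam := by
    have h : X ^ totalExponent laminf lam = X ^ (∑ p : S, lam p) / X ^ (-laminf) := by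
      rw [← Real.rpow_sub hX0, totalExponent]
      congr 1; ring
    rw [h, hV, div_mul_div_comm]
    gcongr
  constructor
  -- By Minkowski's theorem, a determinant below 1 would produce a forbidden lattice point.
  · have hone : 1 ≤ (N : ℝ) ^ n / U * (D / V) ^ n := by
      by_contra! hlt
      obtain ⟨z, hz0, hz⟩ := exists_int_vec_norm_mulVec_lt _ one_pos hdet0 (by
        rw [hdet, abs_of_pos (by positivity), one_pow]; exact hlt)
      exact absurd (hmin z hz0) hz.not_ge
    have h1 : (1 : ℝ) ≤ K₁ * (X ^ (n * totalExponent laminf lam) / X) := by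
      calc 1 ≤ (N : ℝ) ^ n / U * (CD / c₁ * X ^ totalExponent laminf lam) ^ n :=
            hone.trans (by gcongr)
        _ = K₁ * ((X ^ totalExponent laminf lam) ^ n / X) := by
            rw [hK₁, hU, mul_pow, div_pow, pow_succ]; field_simp
        _ = _ := by rw [← Real.rpow_mul_natCast hX0.le, mul_comm (n : ℝ)]
    calc X ^ (1 - n * totalExponent laminf lam)
        ≤ X ^ (1 - n * totalExponent laminf lam) * (K₁ * (X ^ (n * totalExponent laminf lam) / X)) :=
          le_mul_of_one_le_right (by positivity) h1
      _ = K₁ := by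
          rw [Real.rpow_sub hX0, Real.rpow_one]
          field_simp
      _ ≤ K₁ + K₂ := by linarith
  · refine ⟨D, a, hD, ha, hDp, fun Γ hΓ => ?_⟩
    obtain ⟨y, hy1, hy2⟩ := exists_dualPoly_near hN hD hU0 hV0 (hcov _ hdet0 hmin) Γ hΓ
    refine ⟨dualPoly n N D a y, natDegree_dualPoly_le y,
      fun p => norm_aeval_dualPoly_le (hNξ p) (ha p) y, hy1.trans ?_, fun l hl => (hy2 l hl).trans ?_⟩
    · calc C₀ * D * N ^ n / U = C₀ * N ^ n * (D / U) := by ring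
        _ ≤ C₀ * N ^ n * (CD / c₁ * (X ^ totalExponent laminf lam * X ^ (-(laminf + 1)))) := by gcongr
        _ = K₂ * (X ^ totalExponent laminf lam * X ^ (-(laminf + 1))) := by rw [hK₂]; ring
        _ ≤ _ := by gcongr; linarith
    · calc C₀ * D * N ^ n / V = C₀ * N ^ n * (D / V) := by ring
        _ ≤ C₀ * N ^ n * (CD / c₁ * X ^ totalExponent laminf lam) := by gcongr
        _ = K₂ * X ^ totalExponent laminf lam := by rw [hK₂]; ring
        _ ≤ _ := by gcongr; linarith

/-! ### Real roots, heights and exponents. -/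

theorem exists_abs_eval_add_sub_le (P : ℝ[X]) (ξ : ℝ) :
    ∃ K : ℝ, 0 ≤ K ∧ ∀ h : ℝ, |h| ≤ 1 → |P.eval (ξ + h) - P.eval ξ| ≤ K * |h| := by
  induction P using Polynomial.induction_on' with
  | add P Q hP hQ =>
    obtain ⟨K, hK, hP⟩ := hP
    obtain ⟨L, hL, hQ⟩ := hQ
    refine ⟨K + L, add_nonneg hK hL, fun h hh => ?_⟩
    rw [eval_add, eval_add, add_sub_add_comm, add_mul]
    exact (abs_add_le _ _).trans (add_le_add (hP h hh) (hQ h hh))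
  | monomial k r =>
    induction k with
    | zero => exact ⟨0, le_rfl, fun h _ => by simp⟩
    | succ k ih =>
      obtain ⟨K, hK, ih⟩ := ih
      refine ⟨K * (|ξ| + 1) + |(monomial k r).eval ξ|, by positivity, fun h hh => ?_⟩
      have h1 : (monomial (k + 1) r).eval (ξ + h) - (monomial (k + 1) r).eval ξ
          = ((monomial k r).eval (ξ + h) - (monomial k r).eval ξ) * (ξ + h)
            + (monomial k r).eval ξ * h := by
        simp only [eval_monomial]; ring
      rw [h1, add_mul]
      refine (abs_add_le _ _).trans (add_le_add ?_ (abs_mul _ _).le)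
      rw [abs_mul]
      calc _ ≤ K * |h| * (|ξ| + 1) := by
            gcongr
            · exact ih h hh
            · exact (abs_add_le _ _).trans (by gcongr)
        _ = _ := by ring

theorem exists_abs_eval_add_sub_le_of_coeff (n : ℕ) (ξ : ℝ) :
    ∃ K : ℝ, 0 ≤ K ∧ ∀ (e : ℝ[X]) (δ : ℝ), e.natDegree ≤ n → (∀ l, 1 ≤ l → |e.coeff l| ≤ δ) →
      ∀ h : ℝ, |h| ≤ 1 → |e.eval (ξ + h) - e.eval ξ| ≤ K * δ * |h| := by
  choose K hK hKh using fun l : ℕ => exists_abs_eval_add_sub_le (X ^ l : ℝ[X]) ξ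
  refine ⟨∑ l ∈ Finset.range (n + 1), K l, Finset.sum_nonneg fun l _ => hK l,
    fun e δ he hδ h hh => ?_⟩
  have hδ0 : 0 ≤ δ := (abs_nonneg _).trans (hδ 1 le_rfl)
  rw [eval_eq_sum_range' (Nat.lt_succ_of_le he), eval_eq_sum_range' (Nat.lt_succ_of_le he),
    ← Finset.sum_sub_distrib, Finset.sum_mul, Finset.sum_mul]
  refine (Finset.abs_sum_le_sum_abs _ _).trans (Finset.sum_le_sum fun l _ => ?_)
  rcases Nat.eq_zero_or_pos l with rfl | hl
  · simp only [pow_zero, sub_self, abs_zero]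
    have := hK 0
    positivity
  · rw [← mul_sub, abs_mul]
    have h1 := hKh l h hh
    simp only [eval_pow, eval_X] at h1
    calc _ ≤ δ * (K l * |h|) := by gcongr; exact hδ l hl
      _ = _ := by ring

/-- `F` is `R + M x` plus an error whose variation is controlled, and `M` exceeds the Lipschitz
constants of the rest by at least `W`. So `F` moves by at least `W * h₀` in each direction and
changes sign on `[ξ - h₀, ξ + h₀]`. -/
theorem exists_real_root_near {n : ℕ} {ξ KR Kn : ℝ} {F R : ℤ[X]}
    (hKR : ∀ h : ℝ, |h| ≤ 1 → |aeval (ξ + h) R - aeval ξ R| ≤ KR * |h|)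
    (hKn : ∀ (e : ℝ[X]) (δ : ℝ), e.natDegree ≤ n → (∀ l, 1 ≤ l → |e.coeff l| ≤ δ) →
      ∀ h : ℝ, |h| ≤ 1 → |e.eval (ξ + h) - e.eval ξ| ≤ Kn * δ * |h|)
    (hn : 1 ≤ n) (hdeg : (F - R).natDegree ≤ n) {M W δ h₀ : ℝ}
    (hcoeff : ∀ l, 1 ≤ l → |(F.coeff l : ℝ) - R.coeff l - (C M * X : ℝ[X]).coeff l| ≤ δ)
    (hM : W + KR + Kn * δ ≤ M) (h0 : 0 ≤ h₀) (h1 : h₀ ≤ 1) (hval : |aeval ξ F| ≤ W * h₀) :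
    ∃ α : ℝ, aeval α F = 0 ∧ |ξ - α| ≤ h₀ := by
  set e : ℝ[X] := (F - R).map (Int.castRingHom ℝ) - C M * X with he
  have hedeg : e.natDegree ≤ n := (natDegree_sub_le _ _).trans
    (max_le (natDegree_map_le.trans hdeg) (((natDegree_C_mul_le _ _).trans natDegree_X_le).trans hn))
  have hec : ∀ l, 1 ≤ l → |e.coeff l| ≤ δ := by
    intro l hl
    have : e.coeff l = (F.coeff l : ℝ) - R.coeff l - (C M * X : ℝ[X]).coeff l := by
      rw [he, coeff_sub, coeff_map, coeff_sub]; simp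
    rw [this]; exact hcoeff l hl
  have hFe : ∀ x, aeval x F = aeval x R + M * x + e.eval x := by
    intro x
    have : ((F - R).map (Int.castRingHom ℝ)).eval x = aeval x F - aeval x R := by
      rw [eval_map, ← map_sub]; rfl
    rw [he, eval_sub, this]
    simp
  have key : ∀ h : ℝ, |h| ≤ 1 → |aeval (ξ + h) F - aeval ξ F - M * h| ≤ (M - W) * |h| := by
    intro h hh
    have h2 : aeval (ξ + h) F - aeval ξ F - M * h
        = (aeval (ξ + h) R - aeval ξ R) + (e.eval (ξ + h) - e.eval ξ) := by
      rw [hFe, hFe]; ring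
    rw [h2]
    refine (abs_add_le _ _).trans ((add_le_add (hKR h hh) (hKn e δ hedeg hec h hh)).trans ?_)
    rw [← add_mul]
    gcongr
    linarith
  have hpos : 0 ≤ aeval (ξ + h₀) F := by
    have := (abs_le.mp (key h₀ (by rwa [abs_of_nonneg h0]))).1
    rw [abs_of_nonneg h0] at this
    linarith [(abs_le.mp hval).1]
  have hneg : aeval (ξ - h₀) F ≤ 0 := by
    have := (abs_le.mp (key (-h₀) (by rwa [abs_neg, abs_of_nonneg h0]))).2
    rw [abs_neg, abs_of_nonneg h0, ← sub_eq_add_neg] at this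
    linarith [(abs_le.mp hval).2]
  have hcont : Continuous fun x : ℝ => aeval x F := F.continuous_aeval
  obtain ⟨α, hα, hα0⟩ := intermediate_value_Icc (by linarith : ξ - h₀ ≤ ξ + h₀) hcont.continuousOn
    ⟨hneg, hpos⟩
  exact ⟨α, hα0, abs_le.mpr ⟨by linarith [hα.2], by linarith [hα.1]⟩⟩

/-- The dual approximation does not bound the constant coefficient directly; it is recovered from
the value at `ξ` and the other coefficients. -/
theorem polyHeight_le {F : ℤ[X]} {d : ℕ} (hd : F.natDegree ≤ d) {ξ W : ℝ} (hF : |aeval ξ F| ≤ W)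
    (hc : ∀ l, 1 ≤ l → |(F.coeff l : ℝ)| ≤ W) : polyHeight F ≤ (1 + d * (1 + |ξ|) ^ d) * W := by
  have hW : 0 ≤ W := (abs_nonneg _).trans hF
  have hone : 1 ≤ 1 + |ξ| := by linarith [abs_nonneg ξ]
  obtain ⟨l, hl⟩ := F.exists_eq_supNorm
  rw [polyHeight, hl, Int.norm_eq_abs]
  rcases Nat.eq_zero_or_pos l with rfl | hl
  · have h0 : (F.coeff 0 : ℝ) = aeval ξ F - ∑ i ∈ Finset.range d, F.coeff (i + 1) * ξ ^ (i + 1) := by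
      rw [aeval_eq_sum_range' (Nat.lt_succ_of_le hd), Finset.sum_range_succ']
      simp
    rw [h0, add_mul, one_mul]
    refine (abs_sub _ _).trans (add_le_add hF ?_)
    refine (Finset.abs_sum_le_sum_abs _ _).trans ?_
    calc _ ≤ ∑ _i ∈ Finset.range d, (1 + |ξ|) ^ d * W := by
          refine Finset.sum_le_sum fun i hi => ?_
          rw [abs_mul, abs_pow, mul_comm]
          have := Finset.mem_range.mp hi
          gcongr
          · calc |ξ| ^ (i + 1) ≤ (1 + |ξ|) ^ (i + 1) := by gcongr; linarith
              _ ≤ _ := pow_le_pow_right₀ hone (by omega)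
          · exact hc _ (by omega)
      _ = _ := by simp; ring
  · refine (hc l hl).trans (le_mul_of_one_le_left hW ?_)
    have : 0 ≤ (d : ℝ) * (1 + |ξ|) ^ d := by positivity
    linarith

/-- Since `C ≥ 1`, the factor `C ^ (μ / lam)` is replaced by `C ^ B`, free of the exponents. -/
theorem rpow_neg_le_of_le_mul_rpow {X H C lam μ B : ℝ} (hX : 0 < X) (hH : 0 < H) (hC : 1 ≤ C)
    (hlam : 0 < lam) (hμ : 0 ≤ μ) (hμB : μ / lam ≤ B) (hHX : H ≤ C * X ^ lam) :
    X ^ (-μ) ≤ C ^ B * H ^ (-(μ / lam)) := by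
  have hC0 : 0 < C := one_pos.trans_le hC
  have hκ : 0 ≤ μ / lam := by positivity
  calc X ^ (-μ) = (X ^ lam) ^ (-(μ / lam)) := by
        rw [← Real.rpow_mul hX.le, mul_neg, mul_div_cancel₀ _ hlam.ne']
    _ ≤ (H / C) ^ (-(μ / lam)) := by
        refine Real.rpow_le_rpow_of_nonpos (by positivity) ?_ (by linarith)
        rwa [div_le_iff₀' hC0]
    _ = C ^ (μ / lam) * H ^ (-(μ / lam)) := by
        rw [Real.div_rpow hH.le hC0.le, Real.rpow_neg hC0.le, div_inv_eq_mul, mul_comm]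
    _ ≤ _ := by
        gcongr

theorem Padic.inv_norm_natCast_le {p : ℕ} [Fact p.Prime] {N : ℕ} (hN : 0 < N) :
    ‖(N : ℚ_[p])‖⁻¹ ≤ N := by
  rw [Padic.norm_eq_zpow_neg_valuation (by exact_mod_cast hN.ne'), zpow_neg, inv_inv,
    Padic.valuation_natCast, zpow_natCast]
  exact_mod_cast Nat.le_of_dvd hN pow_padicValNat_dvd

/-! ### Assembly of the theorem. -/

theorem mainTheorem4 (n : ℕ) (hn : 1 ≤ n) (S : Finset Nat.Primes)
    (ξinf : ℝ) (ξ : (p : S) → ℚ_[(p.1 : ℕ)])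
    (R : ℤ[X]) (hR : ∀ p : S, ‖aeval (ξ p) R‖ ≤ 1)
    (c : ℝ) (hc : 0 < c) :
    ∃ C : ℝ, 0 < C ∧
      ∀ (laminf : ℝ) (lam : S → ℝ),
        -1 ≤ laminf → (∀ p : S, 0 < lam p) → 0 < totalExponent laminf lam →
        (∃ᶠ X : ℝ in atTop,
          ¬ ∃ x : Fin (n + 1) → ℤ, x ≠ 0 ∧ SatisfiesSystem ξinf ξ laminf lam c X x) →
        {F : ℤ[X] |
          F ≠ 0 ∧
          (R - F).degree ≤ (n : WithBot ℕ) ∧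
          (-1 < laminf →
            ∃ α : ℝ, aeval α F = 0 ∧
              |ξinf - α| ≤
                C * polyHeight F ^ (-((laminf + 1) / totalExponent laminf lam))) ∧
          ∀ p : S, ∃ α : ℚ_[(p.1 : ℕ)], aeval α F = 0 ∧
            ‖ξ p - α‖ ≤ C * polyHeight F ^ (-(lam p / totalExponent laminf lam)) ∧
            (‖ξ p‖ ≤ 1 → ‖α‖ ≤ 1)}.Infinite := by
  obtain ⟨N, hN, hNξ⟩ := exists_nat_norm_mul_le_one S ξ
  obtain ⟨K, hK, hdual⟩ := exists_dual_approx n S ξinf ξ hc hN hNξ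
  obtain ⟨KR, hKR0, hKR⟩ := exists_abs_eval_add_sub_le (R.map (Int.castRingHom ℝ)) ξinf
  replace hKR : ∀ h : ℝ, |h| ≤ 1 → |aeval (ξinf + h) R - aeval ξinf R| ≤ KR * |h| := by
    intro h hh
    have := hKR h hh
    rw [eval_map, eval_map] at this
    exact this
  obtain ⟨Kn, hKn0, hKn⟩ := exists_abs_eval_add_sub_le_of_coeff n ξinf
  have hNR : (0 : ℝ) < N := by exact_mod_cast hN
  set M₀ : ℕ := N ^ n * ∏ p : S, (p.1 : ℕ) with hM₀
  have hM₀R : (0 : ℝ) < M₀ := by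
    exact_mod_cast Nat.mul_pos (pow_pos hN _) (Finset.prod_pos fun (p : S) _ => p.1.2.pos)
  set C₂ : ℝ := M₀ * K with hC₂
  have hC₂0 : 0 < C₂ := by positivity
  set HR : ℝ := polyHeight R with hHR
  have hHR0 : 0 ≤ HR := R.supNorm_nonneg
  have hRc : ∀ l, |(R.coeff l : ℝ)| ≤ HR := fun l => by
    rw [← Int.norm_eq_abs]; exact R.le_supNorm l
  -- The slope will be `A * W` with `W = Y ^ Λ`: large enough to force `W ≤ F.coeff 1` and to meet
  -- the slope condition of `exists_real_root_near`.
  set A : ℝ := 1 + HR + C₂ + KR + Kn * C₂ with hA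
  have hA1 : 1 ≤ A := by
    have : 0 ≤ Kn * C₂ := by positivity
    linarith
  set d : ℕ := max n R.natDegree with hd
  set C₁ : ℝ := (1 + d * (1 + |ξinf|) ^ d) * (HR + A + C₂) with hC₁
  have hC₁1 : 1 ≤ C₁ := by
    refine one_le_mul_of_one_le_of_one_le ?_ (by linarith)
    have : 0 ≤ (d : ℝ) * (1 + |ξinf|) ^ d := by positivity
    linarith
  have hC₁0 : 0 < C₁ := one_pos.trans_le hC₁1
  refine ⟨(C₂ + c * N) * C₁ ^ ((n : ℝ) + 1), by positivity, ?_⟩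
  intro laminf lam hlaminf hlam htot hfreq
  set Λ := totalExponent laminf lam with hΛ
  -- Otherwise `Y ^ (1 - n * Λ)` would be unbounded. Together with `λ_∞ ≥ -1` this bounds all the
  -- ratios `μ / Λ` by `n + 1`.
  have hnΛ : 1 ≤ n * Λ := by
    by_contra! hlt
    have ht := tendsto_rpow_atTop (y := 1 - n * Λ) (by linarith)
    obtain ⟨Y, hX, hX1, hXK⟩ := (hfreq.and_eventually
      ((eventually_ge_atTop 1).and (ht.eventually_gt_atTop K))).exists
    exact absurd (hdual laminf lam Y hlaminf hlam hX1 hX).1 hXK.not_ge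
  have hratio : ∀ μ, μ ≤ Λ + 1 → μ / Λ ≤ n + 1 := by
    intro μ hμ
    rw [div_le_iff₀ htot]
    linarith
  have hlamΛ : ∀ p : S, lam p ≤ Λ + 1 := by
    intro p
    have : lam p ≤ ∑ q : S, lam q :=
      Finset.single_le_sum (fun q _ => (hlam q).le) (Finset.mem_univ p)
    rw [hΛ, totalExponent]
    linarith
  have hinfΛ : laminf + 1 ≤ Λ + 1 := by
    have : 0 ≤ ∑ q : S, lam q := Finset.sum_nonneg fun q _ => (hlam q).le
    rw [hΛ, totalExponent]
    linarith
  -- Infinitude follows from unboundedness of the coefficient of degree 1, which is at least `Y ^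
  -- Λ`.
  refine Set.Infinite.of_image (fun F : ℤ[X] => (F.coeff 1 : ℝ)) (Set.infinite_of_not_bddAbove ?_)
  rintro ⟨b, hb⟩
  have hNp : ∀ p : S, (0 : ℝ) < ‖(N : ℚ_[(p.1 : ℕ)])‖ :=
    fun p => norm_pos_iff.mpr (by exact_mod_cast hN.ne')
  have hev : ∀ᶠ Y : ℝ in atTop, 1 ≤ Y ∧ b < Y ^ Λ ∧
      (-1 < laminf → C₂ * Y ^ (-(laminf + 1)) ≤ 1) ∧
      ∀ p : S, c * Y ^ (-lam p) < ‖(N : ℚ_[(p.1 : ℕ)])‖ ^ (2 * d) := by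
    refine (eventually_ge_atTop 1).and (((tendsto_rpow_atTop htot).eventually_gt_atTop b).and
      (Eventually.and ?_ (eventually_all.mpr fun p => ?_)))
    · by_cases h : -1 < laminf
      · have := (tendsto_rpow_neg_atTop (y := laminf + 1) (by linarith)).const_mul C₂
        rw [mul_zero] at this
        exact (this.eventually_le_const one_pos).mono fun Y hX _ => hX
      · exact Eventually.of_forall fun Y h' => absurd h' h
    · have := (tendsto_rpow_neg_atTop (hlam p)).const_mul c
      rw [mul_zero] at this
      exact this.eventually_lt_const (pow_pos (hNp p) _)
  obtain ⟨Y, hX, hX1, hXb, hXinf, hXp⟩ := (hfreq.and_eventually hev).exists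
  have hY0 : 0 < Y := one_pos.trans_le hX1
  obtain ⟨-, D, a, hD, ha, hDp, hB⟩ := hdual laminf lam Y hlaminf hlam hX1 hX
  set W : ℝ := Y ^ Λ with hW
  have hW1 : 1 ≤ W := Real.one_le_rpow hX1 htot.le
  obtain ⟨F, hFdeg, hFp, hFinf, hFc⟩ :=
    exists_poly_of_dual_approx hn S ξinf ξ R hR hN hD hNξ ha hB (A * W)
  rw [← hM₀, ← mul_assoc, ← hC₂] at hFinf
  replace hFc : ∀ l, 1 ≤ l → |(F.coeff l : ℝ) - R.coeff l - (C (A * W) * X : ℝ[X]).coeff l|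
      ≤ C₂ * W := by
    intro l hl
    have := hFc l hl
    rwa [← hM₀, ← mul_assoc, ← hC₂] at this
  have hF1 : W ≤ F.coeff 1 := by
    have h1 := (abs_le.mp (hFc 1 le_rfl)).1
    rw [coeff_C_mul, coeff_X_one, mul_one] at h1
    have h2 := (abs_le.mp (hRc 1)).1
    have h3 : HR ≤ HR * W := le_mul_of_one_le_right hHR0 hW1
    have h4 : 0 ≤ KR * W := by positivity
    have h5 : 0 ≤ Kn * C₂ * W := by positivity
    have h6 : A * W = W + HR * W + C₂ * W + KR * W + Kn * C₂ * W := by rw [hA]; ring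
    linarith
  have hFd : F.natDegree ≤ d := by
    have : F = R + (F - R) := by ring
    rw [this]
    exact natDegree_add_le_of_degree_le (le_max_right _ _) (hFdeg.trans (le_max_left _ _))
  have hheight : polyHeight F ≤ C₁ * W := by
    have h1 : |aeval ξinf F| ≤ (HR + A + C₂) * W := by
      refine hFinf.trans ?_
      have hle : Y ^ (-(laminf + 1)) ≤ 1 := Real.rpow_le_one_of_one_le_of_nonpos hX1 (by linarith)
      calc C₂ * (W * Y ^ (-(laminf + 1))) ≤ C₂ * (W * 1) := by gcongr
        _ ≤ (HR + A + C₂) * W := by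
          rw [mul_one]
          gcongr
          linarith
    have h2 : ∀ l, 1 ≤ l → |(F.coeff l : ℝ)| ≤ (HR + A + C₂) * W := by
      intro l hl
      have h3 : |(C (A * W) * X : ℝ[X]).coeff l| ≤ A * W := by
        have hAW : 0 ≤ A * W := by positivity
        rw [coeff_C_mul, coeff_X]
        split_ifs
        · rw [mul_one, abs_of_nonneg hAW]
        · simpa using hAW
      have h4 : (F.coeff l : ℝ) = R.coeff l + (C (A * W) * X : ℝ[X]).coeff l
          + ((F.coeff l : ℝ) - R.coeff l - (C (A * W) * X : ℝ[X]).coeff l) := by ring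
      rw [h4]
      calc _ ≤ HR + A * W + C₂ * W :=
            (abs_add_le _ _).trans (add_le_add ((abs_add_le _ _).trans (add_le_add (hRc l) h3)) (hFc l hl))
        _ ≤ HR * W + A * W + C₂ * W := by gcongr; exact le_mul_of_one_le_right hHR0 hW1
        _ = _ := by ring
    rw [hC₁, mul_assoc]
    exact polyHeight_le hFd h1 h2
  have hFne : F ≠ 0 := by
    rintro rfl
    simp at hF1
    linarith
  have hHpos : 0 < polyHeight F := by
    refine lt_of_le_of_ne F.supNorm_nonneg fun h => hFne ?_
    exact supNorm_eq_zero_iff _ |>.mp h.symm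
  have hfin : ∀ (μ : ℝ) {E : ℝ}, 0 ≤ μ → μ ≤ Λ + 1 → E ≤ (C₂ + c * N) * Y ^ (-μ) →
      E ≤ (C₂ + c * N) * C₁ ^ ((n : ℝ) + 1) * polyHeight F ^ (-(μ / Λ)) := by
    intro μ E hμ0 hμ hE
    rw [mul_assoc]
    refine hE.trans (mul_le_mul_of_nonneg_left ?_ (by positivity))
    exact rpow_neg_le_of_le_mul_rpow hY0 hHpos hC₁1 htot hμ0 (hratio _ hμ) hheight
  refine absurd (hb ⟨F, ⟨hFne, ?_, fun hinf => ?_, fun p => ?_⟩, rfl⟩) (hXb.trans_le hF1).not_ge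
  · rw [← neg_sub, degree_neg]
    exact natDegree_le_iff_degree_le.mp hFdeg
  · obtain ⟨α, hα, hξα⟩ := exists_real_root_near (W := W) (M := A * W) (δ := C₂ * W) (h₀ := C₂ * Y ^ (-(laminf + 1)))
      hKR hKn hn hFdeg hFc (by
        have h3 : HR ≤ HR * W := le_mul_of_one_le_right hHR0 hW1
        have h4 : KR ≤ KR * W := le_mul_of_one_le_right hKR0 hW1
        have h5 : 0 ≤ C₂ * W := by positivity
        have h6 : A * W = W + HR * W + C₂ * W + KR * W + Kn * (C₂ * W) := by rw [hA]; ring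
        linarith) (by positivity) (hXinf hinf) (by linarith)
    refine ⟨α, hα, hξα.trans ?_⟩
    refine hfin (laminf + 1) (by linarith) hinfΛ ?_
    gcongr
    exact le_add_of_nonneg_right (by positivity)
  · have hval := ((hFp p).1.trans (hDp p)).trans_lt (hXp p)
    have hN1 : ‖((N : ℤ) : ℚ_[(p.1 : ℕ)])‖ ≤ 1 := Padic.norm_int_le_one _
    rw [Int.cast_natCast] at hN1
    obtain ⟨α, hα, hξα⟩ := exists_padic_root_near F (N := (N : ℤ)) (by exact_mod_cast hN.ne') hFd
      (ξ := ξ p) (by simpa using hNξ p) (by simpa using (hFp p).2) (by simpa using hval)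
    rw [Int.cast_natCast] at hξα
    refine ⟨α, hα, hξα.trans ?_, fun hξ1 => ?_⟩
    · refine hfin (lam p) (hlam p).le (hlamΛ p) ?_
      calc ‖aeval (ξ p) F‖ / ‖(N : ℚ_[(p.1 : ℕ)])‖ ≤ c * Y ^ (-lam p) * N := by
            rw [div_eq_mul_inv]
            exact mul_le_mul ((hFp p).1.trans (hDp p)) (Padic.inv_norm_natCast_le hN)
              (inv_nonneg.mpr (norm_nonneg _)) (by positivity)
        _ = c * N * Y ^ (-lam p) := by ring
        _ ≤ (C₂ + c * N) * Y ^ (-lam p) := by gcongr; linarith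
    -- `|F(ξ p)| < |N| ^ (2 * d) ≤ |N|`, since `d ≥ n ≥ 1`; so `α` is integral when `ξ p` is.
    · have hle : ‖ξ p - α‖ ≤ 1 := by
        refine hξα.trans ((div_le_one (hNp p)).mpr (hval.le.trans ?_))
        refine pow_le_of_le_one (norm_nonneg _) hN1 ?_
        have : n ≤ d := le_max_left _ _
        omega
      have : α = ξ p + -(ξ p - α) := by ring
      rw [this]
      exact (Padic.nonarchimedean _ _).trans (max_le hξ1 (by rwa [norm_neg]))
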